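/- **Conventions.** A *QPT algorithm* is a family $(C_\lambda)_{\lambda\in\mathbb N}$ of quantum circuits (Clifford+$T$ gates, fresh $|0\rangle$ qubits, discarded qubits) whose descriptions are computed from $1^\lambda$ in classical polynomial time; so every algorithm knows the security parameter $\lambda$ and, for each $\lambda$, has inputs and outputs of fixed lengths. A classical output is obtained by measuring the output qubits in the computational basis. Adversaries are QPT algorithms in this (uniform) sense. A function is negligible, $\mathsf{negl}(\lambda)$, if it tends to $0$ faster than every inverse polynomial. A *one-way state generator* (OWSG) is a triple of QPT algorithms: $\mathsf{KeyGen}(1^\lambda)\to k\in\{0,1\}^{\kappa(\lambda)}$ (classical key), $\mathsf{StateGen}(k)\to\phi_k$ (an $m(\lambda)$-qubit, possibly mixed, state) and $\mathsf{Ver}(k',\phi)\to\top/\bot$, such that * (correctness) $\Pr[\top\gets\mathsf{Ver}(k,\phi_k): k\gets\mathsf{KeyGen}(1^\lambda),\ \phi_k\gets\mathsf{StateGen}(k)]\ge 1-\mathsf{negl}(\lambda)$; * (security) for every QPT adversary $\mathcal A$ and every polynomial $t$, $\Pr[\top\gets\mathsf{Ver}(k',\phi_k): k\gets\mathsf{KeyGen}(1^\lambda),\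 \phi_k\gets\mathsf{StateGen}(k),\ k'\gets\mathcal A(\phi_k^{\otimes t(\lambda)})]\le\mathsf{negl}(\lambda)$, where $\mathsf{Ver}$ gets a further copy of $\phi_k$. A *one-time-secure quantum digital signature scheme* (one-time-secure QDS) for $\ell(\lambda)$-bit messages is a quadruple of QPT algorithms: $\mathsf{SKGen}(1^\lambda)\to\mathsf{sk}$ (classical secret key), $\mathsf{PKGen}(\mathsf{sk})\to\mathsf{pk}$ (quantum public key), $\mathsf{Sign}(\mathsf{sk},\mu)\to\sigma$ (classical signature) and $\mathsf{Ver}(\mathsf{pk},\mu,\sigma)\to\top/\bot$, such that * (correctness) for every choice of messages $\mu_\lambda\in\{0,1\}^{\ell(\lambda)}$, an honestly generated signature of $\mu_\lambda$ is accepted under the honestly generated public key with probability at least $1-\mathsf{negl}(\lambda)$; * (one-time security) for every polynomial $t$ and every QPT adversary $\mathcal A$, the following game is won with probability at most $\mathsf{negl}(\lambda)$: the challenger runs $\mathsf{sk}\gets\mathsf{SKGen}(1^\lambda)$, runs $\mathsf{PKGen}(\mathsf{sk})$ $t(\lambda)+1$ times and sends $\mathsf{pk}^{\otimes t(\lambda)}$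 to $\mathcal A$; $\mathcal A$ sends a message $\mu$ and receives $\sigma\gets\mathsf{Sign}(\mathsf{sk},\mu)$; $\mathcal A$ outputs $(\mu',\sigma')$; it wins if $\mu'\ne\mu$ and $\mathsf{Ver}(\mathsf{pk},\mu',\sigma')$, run on the remaining copy of $\mathsf{pk}$, outputs $\top$. **Theorem.** OWSGs exist if and only if one-time-secure QDSs (for messages of some length $\ell(\lambda)\ge1$) exist. More precisely: 1. For every OWSG $(\mathsf{KeyGen},\mathsf{StateGen},\mathsf{Ver})$ there is a one-time-secure QDS for one-bit messages in which the secret key is a pair $\mathsf{sk}=(k_0,k_1)$ of independent outputs of $\mathsf{KeyGen}(1^\lambda)$, the public key of $(k_0,k_1)$ is $\phi_{k_0}\otimes\phi_{k_1}$, the signature of $b\in\{0,1\}$ is $k_b$, and a string $\sigma$ is accepted as a signature of $b$ under the public key $\phi_{k_0}\otimes\phi_{k_1}$ with the probability with which $\mathsf{Ver}(\sigma,\phi_{k_b})$ outputs $\top$. 2. For every one-time-secure QDS for messages of length $\ell(\lambda)\ge1$ with key generation algorithms $\mathsf{SKGen}$ and $\mathsf{PKGen}$ there is an OWSG with $\mathsf{KeyGen}=\mathsf{SKGen}$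 and $\mathsf{StateGen}=\mathsf{PKGen}$; that is, $k=\mathsf{sk}$ and $\phi_k=\mathsf{pk}$. -/

import Mathlib

open scoped BigOperators

noncomputable section

namespace QCrypto

/-! ### Classical polynomial time

Classical data are finite binary trees.  Programs work on one tree at a time, and every elementary
operation is charged the size of the data that it copies, so that the size of a result never
exceeds the running time.  Sequences of trees are nested pairs and a Turing machine configuration
is such a tree, so that polynomial time in this model is ordinary polynomial time. -/

/-- Finite binary trees. -/
inductive BTree : Type
  | nil : BTree
  | node : BTree → BTree → BTree

namespace BTree

/-- The number of vertices of a tree. -/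
def size : BTree → ℕ
  | nil => 1
  | node a b => a.size + b.size + 1

/-- The unary representation of a natural number. -/
def unary : ℕ → BTree
  | 0 => nil
  | n + 1 => node nil (unary n)

end BTree

/-- Programs of a `while` language on binary trees. -/
inductive Prog : Type
  | id : Prog
  | nil : Prog
  | fst : Prog
  | snd : Prog
  | pair : Prog → Prog → Prog
  | comp : Prog → Prog → Prog
  | ite : Prog → Prog → Prog → Prog
  | loop : Prog → Prog → Prog

open BTree in
/-- `Runs p x y c`: on input `x` the program `p` halts with output `y` in time `c`.
`comp p q` is "first `p`, then `q`"; `ite t p q` is "if `t` returns a non-empty tree then `p`,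
else `q`"; `loop t p` is "while `t` returns a non-empty tree do `p`". -/
inductive Runs : Prog → BTree → BTree → ℕ → Prop
  | id (x : BTree) : Runs .id x x x.size
  | nil (x : BTree) : Runs .nil x .nil 1
  | fst_nil : Runs .fst .nil .nil 1
  | fst_node (a b : BTree) : Runs .fst (node a b) a (node a b).size
  | snd_nil : Runs .snd .nil .nil 1
  | snd_node (a b : BTree) : Runs .snd (node a b) b (node a b).size
  | pair {p q : Prog} {x y z : BTree} {c d : ℕ} :
      Runs p x y c → Runs q x z d → Runs (.pair p q) x (node y z) (c + d + 1)
  | comp {p q : Prog} {x y z : BTree} {c d : ℕ} :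
      Runs p x y c → Runs q y z d → Runs (.comp p q) x z (c + d + 1)
  | ite_true {t p q : Prog} {x a b y : BTree} {c d : ℕ} :
      Runs t x (node a b) c → Runs p x y d → Runs (.ite t p q) x y (c + d + 1)
  | ite_false {t p q : Prog} {x y : BTree} {c d : ℕ} :
      Runs t x .nil c → Runs q x y d → Runs (.ite t p q) x y (c + d + 1)
  | loop_stop {t p : Prog} {x : BTree} {c : ℕ} :
      Runs t x .nil c → Runs (.loop t p) x x (c + x.size + 1)
  | loop_step {t p : Prog} {x a b y z : BTree} {c d e : ℕ} :
      Runs t x (node a b) c → Runs p x y d → Runs (.loop t p) y z e →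
        Runs (.loop t p) x z (c + d + e + 1)

/-- `f` is computed, on input `1ⁿ`, by a program in time polynomial in `n`. -/
def PolyTime (f : ℕ → BTree) : Prop :=
  ∃ (p : Prog) (T : Polynomial ℕ), ∀ n : ℕ, ∃ c : ℕ, c ≤ T.eval n ∧ Runs p (.unary n) (f n) c

/-! ### Quantum states and quantum circuits -/

/-- Bit strings of length `n`, which label the computational basis of `n` qubits. -/
abbrev Bits (n : ℕ) : Type := Fin n → Bool

/-- The first `a` bits of a string of length `a + b`. -/
def left {a b : ℕ} (x : Bits (a + b)) : Bits a := fun i => x (Fin.castAdd b i)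

/-- The last `b` bits of a string of length `a + b`. -/
def right {a b : ℕ} (x : Bits (a + b)) : Bits b := fun i => x (Fin.natAdd a i)

/-- Operators on `n` qubits, in particular density operators. -/
abbrev Op (n : ℕ) : Type := Matrix (Bits n) (Bits n) ℂ

/-- Linear maps from operators on `a` qubits to operators on `b` qubits, written as matrices
with respect to the matrix units `|u⟩⟨u'|` and `|y⟩⟨y'|`. -/
abbrev Superop (a b : ℕ) : Type := Matrix (Bits b × Bits b) (Bits a × Bits a) ℂ

/-- The superoperator `ρ ↦ U ρ U†`. -/
def conjBy {a b : ℕ} (U : Matrix (Bits b) (Bits a) ℂ) : Superop a b :=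
  Matrix.of fun y u => U y.1 u.1 * star (U y.2 u.2)

/-- The matrix `|u⟩ ↦ |f u⟩`. -/
def classicalMap {a b : ℕ} (f : Bits a → Bits b) : Matrix (Bits b) (Bits a) ℂ :=
  Matrix.of fun y u => if y = f u then 1 else 0

/-- Tensor product of superoperators. -/
def Superop.tensor {a b c d : ℕ} (S : Superop a b) (R : Superop c d) :
    Superop (a + c) (b + d) :=
  Matrix.of fun y u =>
    S (left y.1, left y.2) (left u.1, left u.2) * R (right y.1, right y.2) (right u.1, right u.2)

/-- The Hadamard gate. -/
def hadamardMatrix : Op 1 :=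
  Matrix.of fun y u => (if y 0 && u 0 then -1 else 1) * ((Real.sqrt 2)⁻¹ : ℂ)

/-- The `T` gate (phase `π/4`). -/
def tMatrix : Op 1 :=
  Matrix.diagonal fun u => if u 0 then Complex.exp (Real.pi / 4 * Complex.I) else 1

/-- Quantum circuits with `a` input qubits and `b` output qubits over the universal gate set
Clifford + T (with redundant `X` and Toffoli gates), with fresh qubits in the state `|0⟩`,
with qubits that are traced out, and with free rearrangement of wires
(`swap a b` exchanges a block of `a` wires with a block of `b` wires). -/
inductive QCirc : ℕ → ℕ → Type
  | x : QCirc 1 1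
  | h : QCirc 1 1
  | t : QCirc 1 1
  | cnot : QCirc 2 2
  | ccnot : QCirc 3 3
  | init : QCirc 0 1
  | discard : QCirc 1 0
  | wires (n : ℕ) : QCirc n n
  | swap (a b : ℕ) : QCirc (a + b) (b + a)
  | seq {a b c : ℕ} : QCirc a b → QCirc b c → QCirc a c
  | par {a b c d : ℕ} : QCirc a b → QCirc c d → QCirc (a + c) (b + d)

namespace QCirc

/-- The quantum channel implemented by a circuit. -/
def denote : {a b : ℕ} → QCirc a b → Superop a b
  | _, _, x => conjBy (classicalMap fun u => ![!(u 0)])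
  | _, _, h => conjBy hadamardMatrix
  | _, _, t => conjBy tMatrix
  | _, _, cnot => conjBy (classicalMap fun u => ![u 0, xor (u 1) (u 0)])
  | _, _, ccnot => conjBy (classicalMap fun u => ![u 0, u 1, xor (u 2) (u 0 && u 1)])
  | _, _, init => conjBy (classicalMap fun _ => ![false])
  | _, _, discard => Matrix.of fun _ u => if u.1 = u.2 then 1 else 0
  | _, _, wires _ => 1
  | _, _, swap _ _ => conjBy (classicalMap fun u => Fin.append (right u) (left u))
  | _, _, seq C D => D.denote * C.denote
  | _, _, par C D => C.denote.tensor D.denote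

/-- The description of the inner structure of a circuit. -/
def code : {a b : ℕ} → QCirc a b → BTree
  | _, _, x => .node (.unary 0) .nil
  | _, _, h => .node (.unary 1) .nil
  | _, _, t => .node (.unary 2) .nil
  | _, _, cnot => .node (.unary 3) .nil
  | _, _, ccnot => .node (.unary 4) .nil
  | _, _, init => .node (.unary 5) .nil
  | _, _, discard => .node (.unary 6) .nil
  | _, _, wires n => .node (.unary 7) (.unary n)
  | _, _, swap a b => .node (.unary 8) (.node (.unary a) (.unary b))
  | _, _, seq C D => .node (.unary 9) (.node C.code D.code)
  | _, _, par C D => .node (.unary 10) (.node C.code D.code)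

/-- The full description of a circuit: numbers of input and output wires, and its structure. -/
def encode {a b : ℕ} (C : QCirc a b) : BTree :=
  .node (.unary a) (.node (.unary b) C.code)

/-- The output state of a circuit on the input state `ρ`. -/
def run {a b : ℕ} (C : QCirc a b) (ρ : Op a) : Op b :=
  Matrix.of fun y y' => ∑ u : Bits a, ∑ u' : Bits a, C.denote (y, y') (u, u') * ρ u u'

end QCirc

/-- A quantum polynomial-time algorithm: a family of quantum circuits, one for each security
parameter `n`, whose description is computed from `1ⁿ` in classical polynomial time.
On security parameter `n` it has `a n` input and `b n` output qubits. -/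
structure QPT (a b : ℕ → ℕ) where
  circ : (n : ℕ) → QCirc (a n) (b n)
  uniform : PolyTime fun n => (circ n).encode

/-- The output state of an algorithm for security parameter `n`. -/
def QPT.run {a b : ℕ → ℕ} (A : QPT a b) (n : ℕ) (ρ : Op (a n)) : Op (b n) :=
  (A.circ n).run ρ

/-- The state `|x⟩⟨x|`, which carries the classical string `x`. -/
def ket {n : ℕ} (x : Bits n) : Op n := Matrix.single x x 1

/-- The state `ρ ⊗ σ`. -/
def tensorState {a b : ℕ} (ρ : Op a) (σ : Op b) : Op (a + b) :=
  Matrix.of fun x y => ρ (left x) (left y) * σ (right x) (right y)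

/-- The state `ρ^{⊗ t}`. -/
def copies (t : ℕ) {m : ℕ} (ρ : Op m) : Op (t * m) :=
  Matrix.of fun x y => ∏ i : Fin t,
    ρ (fun j => x (finProdFinEquiv (i, j))) (fun j => y (finProdFinEquiv (i, j)))

/-- The probability of the outcome `x` when `ρ` is measured in the computational basis. -/
def prob {n : ℕ} (ρ : Op n) (x : Bits n) : ℝ := (ρ x x).re

/-- The state, multiplied by the probability of the outcome, in which the last `b` qubits of `ρ`
are left when the first `a` qubits are measured with outcome `x`. -/
def afterMeasuring {a b : ℕ} (ρ : Op (a + b)) (x : Bits a) : Op b :=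
  Matrix.of fun y y' => ρ (Fin.append x y) (Fin.append x y')

/-- The probability that a one-qubit output is measured as `1`, which stands for acceptance. -/
def accept (ρ : Op 1) : ℝ := prob ρ fun _ => true

/-- Negligible functions of the security parameter. -/
def Negligible (f : ℕ → ℝ) : Prop :=
  Asymptotics.SuperpolynomialDecay Filter.atTop (fun n : ℕ => (n : ℝ)) f

/-! ### One-way state generators -/

/-- The algorithms of a one-way state generator with `κ n`-bit keys and `m n`-qubit states. -/
structure OWSGScheme (κ m : ℕ → ℕ) where
  keyGen : QPT (fun _ => 0) κ
  stateGen : QPT κ m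
  ver : QPT (fun n => κ n + m n) fun _ => 1

namespace OWSGScheme

variable {κ m : ℕ → ℕ} (G : OWSGScheme κ m)

/-- `Pr[k ← KeyGen(1ⁿ)]`. -/
def keyProb (n : ℕ) (k : Bits (κ n)) : ℝ := prob (G.keyGen.run n 1) k

/-- The state `φ_k`. -/
def state (n : ℕ) (k : Bits (κ n)) : Op (m n) := G.stateGen.run n (ket k)

/-- `Pr[⊤ ← Ver(k', φ)]`. -/
def verProb (n : ℕ) (k' : Bits (κ n)) (φ : Op (m n)) : ℝ :=
  accept (G.ver.run n (tensorState (ket k') φ))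

/-- The probability that an honestly generated key is accepted. -/
def correctProb (n : ℕ) : ℝ :=
  ∑ k : Bits (κ n), G.keyProb n k * G.verProb n k (G.state n k)

/-- The probability that the key found by `A` from `t(n)` copies of `φ_k` is accepted. -/
def attackProb (t : Polynomial ℕ) (A : QPT (fun n => t.eval n * m n) κ) (n : ℕ) : ℝ :=
  ∑ k : Bits (κ n), ∑ k' : Bits (κ n),
    G.keyProb n k * prob (A.run n (copies (t.eval n) (G.state n k))) k' *
      G.verProb n k' (G.state n k)

def Correct : Prop := Negligible fun n => 1 - G.correctProb n

def Secure : Prop :=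
  ∀ (t : Polynomial ℕ) (A : QPT (fun n => t.eval n * m n) κ), Negligible (G.attackProb t A)

/-- The algorithms form a one-way state generator. -/
def IsOWSG : Prop := G.Correct ∧ G.Secure

end OWSGScheme

/-! ### Quantum digital signatures -/

/-- The algorithms of a quantum digital signature scheme with `l n`-bit messages, `s n`-bit secret
keys, `p n`-qubit public keys and `g n`-bit signatures. -/
structure QDSScheme (l s p g : ℕ → ℕ) where
  skGen : QPT (fun _ => 0) s
  pkGen : QPT s p
  sign : QPT (fun n => s n + l n) g
  ver : QPT (fun n => p n + (l n + g n)) fun _ => 1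

/-- An adversary in the one-time security game that gets `t(n)` copies of the public key.
It first outputs a message and keeps `w n` qubits; then it gets a signature and outputs a message
together with an alleged signature. -/
structure OneTimeAdversary (l p g : ℕ → ℕ) (t : Polynomial ℕ) where
  w : ℕ → ℕ
  query : QPT (fun n => t.eval n * p n) fun n => l n + w n
  forge : QPT (fun n => g n + w n) fun n => l n + g n

namespace QDSScheme

variable {l s p g : ℕ → ℕ} (S : QDSScheme l s p g)

/-- `Pr[sk ← SKGen(1ⁿ)]`. -/
def skProb (n : ℕ) (sk : Bits (s n)) : ℝ := prob (S.skGen.run n 1) sk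

/-- The public key that belongs to `sk`. -/
def pk (n : ℕ) (sk : Bits (s n)) : Op (p n) := S.pkGen.run n (ket sk)

/-- `Pr[σ ← Sign(sk, μ)]`. -/
def signProb (n : ℕ) (sk : Bits (s n)) (μ : Bits (l n)) (σ : Bits (g n)) : ℝ :=
  prob (S.sign.run n (tensorState (ket sk) (ket μ))) σ

/-- `Pr[⊤ ← Ver(ρ, μ, σ)]`. -/
def verProb (n : ℕ) (ρ : Op (p n)) (μ : Bits (l n)) (σ : Bits (g n)) : ℝ :=
  accept (S.ver.run n (tensorState ρ (tensorState (ket μ) (ket σ))))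

/-- The probability that an honest signature of `μ` is accepted. -/
def correctProb (n : ℕ) (μ : Bits (l n)) : ℝ :=
  ∑ sk : Bits (s n), ∑ σ : Bits (g n),
    S.skProb n sk * S.signProb n sk μ σ * S.verProb n (S.pk n sk) μ σ

/-- The probability that `A` wins the one-time security game: it asks for a signature `σ` of `μ`
and returns a message `μ' ≠ μ` and a string `σ'` that is accepted as a signature of `μ'`. -/
def attackProb {t : Polynomial ℕ} (A : OneTimeAdversary l p g t) (n : ℕ) : ℝ :=
  ∑ sk : Bits (s n), ∑ μ : Bits (l n), ∑ σ : Bits (g n), ∑ μ' : Bits (l n), ∑ σ' : Bits (g n),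
    if μ' ≠ μ then
      S.skProb n sk * S.signProb n sk μ σ *
        prob (A.forge.run n (tensorState (ket σ)
          (afterMeasuring (A.query.run n (copies (t.eval n) (S.pk n sk))) μ)))
          (Fin.append μ' σ') *
        S.verProb n (S.pk n sk) μ' σ'
    else 0

def Correct : Prop :=
  ∀ μ : (n : ℕ) → Bits (l n), Negligible fun n => 1 - S.correctProb n (μ n)

def OneTimeSecure : Prop :=
  ∀ (t : Polynomial ℕ) (A : OneTimeAdversary l p g t), Negligible (S.attackProb A)

/-- The algorithms form a one-time-secure quantum digital signature scheme. -/
def IsOneTimeQDS : Prop := S.Correct ∧ S.OneTimeSecure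

end QDSScheme

end QCrypto

end

noncomputable section

namespace QCrypto

section

open BTree

/-! ### Polynomial-time functions on encoded data -/

/-! Both directions are reductions between games, carried out on explicit circuits.

From a generator to signatures the scheme is Lamport's. A forger that sees `k_{!v}` and then signs
`v` has found a key accepted for `φ_{k_v}`. To attack the generator, place the challenge copies at
position `v`, generate a fresh key with its states for the other position, run the forger, answer
its query with the fresh key whatever was asked, and output the forged string. If the query was `!v`
the simulation is perfect, and all other runs contribute nonnegative terms, so `winProb_le` bounds
the forger's success on `v` by the attack probability. Since the bit `v` takes two values,
`attackProb_toQDS` writes the total success as a sum of two negligible functions; no guessing of `v`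
is needed.

From signatures to a generator, a claimed key is tested by signing the zero message with it and
verifying under the state. Correctness is that of the zero message. A key finder becomes a forger
that asks for the all-ones message, ignores the answer, finds a key and signs zero; by
`attackProb_keyAdversary` the two winning probabilities are equal as soon as messages have at least
one bit.

Two supporting facts are needed. Circuits must be trace preserving (`trace_run`), so that unused
keys and signatures have total probability one, and completely positive (`posSemidef_run`), so that
probabilities are real and nonnegative. All reductions must be uniform: their descriptions are
computed by recursion along unary numbers, with growth controlled by `recursion_of_growth`.
Throughout, `size_le` is what lets running times compose, since it bounds an intermediate result by
the time spent on it. -/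

theorem Runs.size_le {p : Prog} {x y : BTree} {c : ℕ} (h : Runs p x y c) : y.size ≤ c := by
  induction h with
  | id => exact le_rfl
  | nil | fst_nil | snd_nil => exact le_rfl
  | _ => try simp only [BTree.size] at *
         omega

@[simp] theorem BTree.size_unary (n : ℕ) : (unary n).size = 2 * n + 1 := by
  induction n with
  | zero => rfl
  | succ n ih => simp only [unary, BTree.size, ih]; omega

/-- Natural coefficients make polynomial time bounds monotone, so size estimates may be substituted
into them. -/
theorem eval_nat_mono (T : Polynomial ℕ) : Monotone fun n => T.eval n := by
  intro a b h
  simp only [Polynomial.eval_eq_sum, Polynomial.sum]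
  exact Finset.sum_le_sum fun i _ => Nat.mul_le_mul_left _ (Nat.pow_le_pow_left h i)

/-- The right subtree. -/
def BTree.tail : BTree → BTree
  | .nil => .nil
  | .node _ b => b

/-- `f a` is computed from `e a` in time polynomial in the size of `e a`. -/
def PTime {α : Type} (e f : α → BTree) : Prop :=
  ∃ (p : Prog) (T : Polynomial ℕ), ∀ a, ∃ c, c ≤ T.eval (e a).size ∧ Runs p (e a) (f a) c

theorem polyTime_iff {f : ℕ → BTree} : PolyTime f ↔ PTime unary f := by
  constructor
  · rintro ⟨p, T, h⟩
    refine ⟨p, T, fun n => ?_⟩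
    obtain ⟨c, hc, hr⟩ := h n
    exact ⟨c, hc.trans (eval_nat_mono T (by simp; omega)), hr⟩
  · rintro ⟨p, T, h⟩
    -- `unary n` has `2n + 1` vertices.
    refine ⟨p, T.comp (2 * Polynomial.X + 1), fun n => ?_⟩
    obtain ⟨c, hc, hr⟩ := h n
    exact ⟨c, by simpa using hc, hr⟩

namespace PTime

variable {α : Type} {e f g h : α → BTree}

theorem size_bound (hf : PTime e f) : ∃ T : Polynomial ℕ, ∀ a, (f a).size ≤ T.eval (e a).size := by
  obtain ⟨p, T, hp⟩ := hf
  refine ⟨T, fun a => ?_⟩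
  obtain ⟨c, hc, hr⟩ := hp a
  exact hr.size_le.trans hc

protected theorem id : PTime e e :=
  ⟨.id, Polynomial.X, fun a => ⟨_, by simp, .id _⟩⟩

protected theorem nil : PTime e fun _ => .nil :=
  ⟨.nil, 1, fun a => ⟨_, by simp, .nil _⟩⟩

theorem comp (hf : PTime e f) (hg : PTime f g) : PTime e g := by
  obtain ⟨p, T, hp⟩ := hf
  obtain ⟨q, U, hq⟩ := hg
  refine ⟨.comp p q, T + U.comp T + 1, fun a => ?_⟩
  obtain ⟨c, hc, hr⟩ := hp a
  obtain ⟨d, hd, hs⟩ := hq a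
  refine ⟨_, ?_, .comp hr hs⟩
  have := hd.trans (eval_nat_mono U (hr.size_le.trans hc))
  simp only [Polynomial.eval_add, Polynomial.eval_comp, Polynomial.eval_one]
  simp only at this
  omega

theorem node (hf : PTime e f) (hg : PTime e g) : PTime e fun a => .node (f a) (g a) := by
  obtain ⟨p, T, hp⟩ := hf
  obtain ⟨q, U, hq⟩ := hg
  refine ⟨.pair p q, T + U + 1, fun a => ?_⟩
  obtain ⟨c, hc, hr⟩ := hp a
  obtain ⟨d, hd, hs⟩ := hq a
  refine ⟨_, ?_, .pair hr hs⟩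
  simp only [Polynomial.eval_add, Polynomial.eval_one]
  omega

theorem fst (hf : PTime e fun a => .node (f a) (g a)) : PTime e f :=
  hf.comp ⟨.fst, Polynomial.X, fun a => ⟨_, by simp, .fst_node _ _⟩⟩

theorem snd (hf : PTime e fun a => .node (f a) (g a)) : PTime e g :=
  hf.comp ⟨.snd, Polynomial.X, fun a => ⟨_, by simp, .snd_node _ _⟩⟩

theorem const (t : BTree) : PTime e fun _ => t := by
  induction t with
  | nil => exact .nil
  | node a b iha ihb => exact iha.node ihb

theorem reindex {β : Type} (hf : PTime e f) (k : β → α) : PTime (e ∘ k) (f ∘ k) := by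
  obtain ⟨p, T, hp⟩ := hf
  exact ⟨p, T, fun b => hp (k b)⟩

theorem loop_value :
    PTime (fun x : α × ℕ × BTree => .node (e x.1) (.node (unary x.2.1) x.2.2))
      fun x => x.2.2 :=
  PTime.id.snd.snd

/-- Recursion along a unary number, where each step adds data of polynomial size. -/
theorem recursion_of_growth {r : α → ℕ} {F D : α → ℕ → BTree}
    (hr : PTime e fun a => unary (r a)) (h0 : PTime e fun a => F a 0)
    (hS : PTime (fun x : α × ℕ => .node (e x.1) (.node (unary x.2) (F x.1 x.2)))
      fun x => F x.1 (x.2 + 1))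
    (hG : PTime (fun x : α × ℕ => .node (e x.1) (unary x.2)) fun x => D x.1 x.2)
    (hg : ∀ a i, (F a (i + 1)).size ≤ (F a i).size + (D a i).size) :
    PTime e fun a => F a (r a) := by
  obtain ⟨R, hR⟩ := hr.size_bound
  obtain ⟨Z, hZ⟩ := h0.size_bound
  obtain ⟨G, hG⟩ := hG.size_bound
  obtain ⟨p, T, hp⟩ := hS
  -- a bound for the size of the intermediate values
  let E : Polynomial ℕ := G.comp (Polynomial.X + 2 * R + 4)
  have hD : ∀ a i, i ≤ r a → (D a i).size ≤ E.eval (e a).size := by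
    intro a i hi
    refine (hG (a, i)).trans ?_
    simp only [E, Polynomial.eval_comp]
    refine eval_nat_mono G ?_
    have := hR a
    simp only [BTree.size, size_unary] at *
    simp
    omega
  let B : Polynomial ℕ := Z + R * E
  -- The increments are bounded independently of the current value, so growth is additive over at
  -- most `r a` steps; a multiplicative bound would allow exponential size.
  have hB' : ∀ a i, i ≤ r a → (F a i).size ≤ (F a 0).size + i * E.eval (e a).size := by
    intro a i
    induction i with
    | zero => simp
    | succ i ih =>
      intro hi
      have h1 := hg a i
      have h2 := hD a i (by omega)
      have h3 := ih (by omega)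
      rw [add_mul]
      omega
  have hB : ∀ a i, i ≤ r a → (F a i).size ≤ B.eval (e a).size := by
    intro a i hi
    refine (hB' a i hi).trans ?_
    simp only [B, Polynomial.eval_add, Polynomial.eval_mul]
    refine Nat.add_le_add (hZ a) (Nat.mul_le_mul_right _ ?_)
    have := hR a
    rw [size_unary] at this
    omega
  -- the time of a single step
  let U : Polynomial ℕ := T.comp (Polynomial.X + R + B + 2)
  have hU : ∀ a i, i ≤ r a → ∃ c, c ≤ U.eval (e a).size ∧
      Runs p (.node (e a) (.node (unary i) (F a i))) (F a (i + 1)) c := by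
    intro a i hi
    obtain ⟨c, hc, hrun⟩ := hp (a, i)
    refine ⟨c, hc.trans ?_, hrun⟩
    simp only [U, Polynomial.eval_comp]
    refine eval_nat_mono T ?_
    have h1 := hR a
    have h2 := hB a i hi
    simp only [BTree.size, size_unary] at *
    simp
    omega
  -- The loop state carries the number of remaining steps in front, so that `.fst` serves as the
  -- loop test and fails exactly when the counter has become `nil`.
  let st : α → ℕ → BTree := fun a i =>
    .node (unary (r a - i)) (.node (e a) (.node (unary i) (F a i)))
  have hst : ∀ a i, i ≤ r a → (st a i).size ≤ (Polynomial.X + 2 * R + B + 3).eval (e a).size := by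
    intro a i hi
    have h1 := hR a
    have h2 := hB a i hi
    simp only [st, BTree.size, size_unary] at *
    simp
    omega
  let body : Prog := .pair (.comp .fst .snd) (.comp .snd (.pair .fst
    (.pair (.pair .nil (.comp .snd .fst)) p)))
  let W : Polynomial ℕ := Polynomial.X + 2 * R + B + 3
  let V : Polynomial ℕ := 10 * W + U + 10
  have hbody : ∀ a i, i < r a → ∃ c, c ≤ V.eval (e a).size ∧
      Runs body (st a i) (st a (i + 1)) c := by
    intro a i hi
    obtain ⟨c, hc, hrun⟩ := hU a i hi.le
    have hsz := hst a i hi.le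
    obtain ⟨k, hk⟩ : ∃ k, r a - i = k + 1 := ⟨r a - i - 1, by omega⟩
    have hk' : r a - (i + 1) = k := by omega
    -- Besides `p`, the body makes six projections, each charged at most the size of the state; the
    -- factor 10 is generous.
    have hrun' : ∃ d, d ≤ 10 * (st a i).size + c + 10 ∧ Runs body (st a i) (st a (i + 1)) d := by
      simp only [st, hk, hk']
      refine ⟨_, ?_, .pair (.comp (.fst_node _ _) (.snd_node _ _)) (.comp (.snd_node _ _)
        (.pair (.fst_node _ _) (.pair (.pair (.nil _) (.comp (.snd_node _ _) (.fst_node _ _)))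
          hrun)))⟩
      simp only [BTree.size, size_unary]
      omega
    obtain ⟨d, hd, hrun''⟩ := hrun'
    refine ⟨d, hd.trans ?_, hrun''⟩
    simp only [V, W, Polynomial.eval_add, Polynomial.eval_mul, Polynomial.eval_ofNat] at *
    omega
  have hloop : ∀ a k i, i + k = r a → ∃ c, c ≤ k * (V + W + 1).eval (e a).size +
      (2 * W + 1).eval (e a).size ∧ Runs (.loop .fst body) (st a i) (st a (r a)) c := by
    intro a k
    induction k with
    | zero =>
      intro i hi
      have hi : i = r a := by omega
      subst hi
      have hsz := hst a (r a) le_rfl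
      have ht : Runs .fst (st a (r a)) .nil (st a (r a)).size := by
        have : unary (r a - r a) = .nil := by simp [unary]
        simp only [st, this]
        exact .fst_node _ _
      refine ⟨(st a (r a)).size + (st a (r a)).size + 1, ?_, by constructor; exact ht⟩
      simp only [W, Polynomial.eval_add, Polynomial.eval_mul, Polynomial.eval_ofNat,
        Polynomial.eval_one] at *
      omega
    | succ k ih =>
      intro i hi
      obtain ⟨c, hc, hrun⟩ := ih (i + 1) (by omega)
      obtain ⟨d, hd, hrun'⟩ := hbody a i (by omega)
      have hsz := hst a i (by omega)
      have ht : Runs .fst (st a i) (.node .nil (unary k)) (st a i).size := by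
        have : r a - i = k + 1 := by omega
        simp only [st, this]
        exact .fst_node _ _
      refine ⟨_, ?_, .loop_step ht hrun' hrun⟩
      rw [add_mul]
      simp only [V, W, Polynomial.eval_add, Polynomial.eval_mul, Polynomial.eval_ofNat,
          Polynomial.eval_one] at *
      omega
  have hfinal : PTime (fun a => st a 0) fun a => st a (r a) := by
    refine ⟨.loop .fst body, (Polynomial.X * (V + W + 1) + (2 * W + 1)), fun a => ?_⟩
    obtain ⟨c, hc, hrun⟩ := hloop a (r a) 0 (by omega)
    refine ⟨c, hc.trans ?_, hrun⟩
    have h1 : (e a).size ≤ (st a 0).size := by simp only [st, BTree.size]; omega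
    have h2 : r a ≤ (st a 0).size := by simp only [st, BTree.size, size_unary]; omega
    have heval : ∀ (P Q : Polynomial ℕ) (n : ℕ),
        (Polynomial.X * P + Q).eval n = n * P.eval n + Q.eval n := by simp
    rw [heval]
    exact Nat.add_le_add (Nat.mul_le_mul h2 (eval_nat_mono _ h1)) (eval_nat_mono (2 * W + 1) h1)
  have hinit : PTime e fun a => st a 0 := hr.node (PTime.id.node (PTime.nil.node h0))
  exact (hinit.comp hfinal).snd.snd.snd

/-- Recursion along a unary number for a step that is given on all trees. -/
theorem recursion {r : α → ℕ} {F : α → ℕ → BTree} {S : α → ℕ → BTree → BTree}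
    (hr : PTime e fun a => unary (r a)) (h0 : PTime e fun a => F a 0)
    (hS : PTime (fun x : α × ℕ × BTree => .node (e x.1) (.node (unary x.2.1) x.2.2))
      fun x => S x.1 x.2.1 x.2.2)
    (hg : ∀ a i T, (S a i T).size ≤ T.size + (S a i .nil).size)
    (hF : ∀ a i, F a (i + 1) = S a i (F a i)) :
    PTime e fun a => F a (r a) := by
  refine recursion_of_growth (D := fun a i => S a i .nil) hr h0 ?_ ?_ fun a i => by
    rw [hF]; exact hg a i _
  · simp only [hF]
    exact hS.reindex fun x : α × ℕ => (x.1, x.2, F x.1 x.2)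
  · exact (PTime.id.fst.node (PTime.id.snd.node .nil)).comp
      (hS.reindex fun x : α × ℕ => (x.1, x.2, BTree.nil))

variable {r s : α → ℕ}

theorem succ (hr : PTime e fun a => unary (r a)) : PTime e fun a => unary (r a + 1) :=
  PTime.nil.node hr

theorem add (hr : PTime e fun a => unary (r a)) (hs : PTime e fun a => unary (s a)) :
    PTime e fun a => unary (r a + s a) :=
  recursion (F := fun a i => unary (r a + i)) (S := fun _ _ T => .node .nil T) hs hr
    (PTime.nil.node loop_value) (fun _ _ _ => by simp only [BTree.size]; omega) fun _ _ => rfl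

theorem mul (hr : PTime e fun a => unary (r a)) (hs : PTime e fun a => unary (s a)) :
    PTime e fun a => unary (r a * s a) := by
  refine recursion_of_growth (F := fun a i => unary (i * s a)) (D := fun a _ => unary (s a))
    hr (by simpa only [Nat.zero_mul] using .nil) ?_ ?_ fun a i => ?_
  · simp only [Nat.succ_mul]
    exact PTime.id.snd.snd.add (PTime.id.fst.comp (hs.reindex Prod.fst))
  · exact PTime.id.fst.comp (hs.reindex Prod.fst)
  · simp only [size_unary, Nat.succ_mul]
    omega

theorem tail (hf : PTime e f) : PTime e fun a => (f a).tail := by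
  refine hf.comp ⟨.snd, Polynomial.X, fun a => ?_⟩
  dsimp only
  rcases f a with _ | ⟨x, y⟩
  · exact ⟨1, by simp [BTree.size], .snd_nil⟩
  · exact ⟨_, by simp, .snd_node _ _⟩

/-- Truncated subtraction is iterated `tail`, because `tail` fixes `nil` just as the predecessor
fixes zero. -/
theorem sub (hr : PTime e fun a => unary (r a)) (hs : PTime e fun a => unary (s a)) :
    PTime e fun a => unary (r a - s a) :=
  recursion (F := fun a i => unary (r a - i)) (S := fun _ _ T => T.tail) hs hr
    (tail loop_value) (fun _ _ T => by cases T <;> simp only [BTree.size, BTree.tail] <;> omega)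
    fun a i => by
      rw [← Nat.sub_sub]
      cases r a - i <;> rfl

theorem eval_polynomial (hr : PTime e fun a => unary (r a)) (t : Polynomial ℕ) :
    PTime e fun a => unary (t.eval (r a)) := by
  induction t using Polynomial.induction_on' with
  | add p q hp hq => simpa only [Polynomial.eval_add] using hp.add hq
  | monomial k c =>
    simp only [Polynomial.eval_monomial]
    refine (const (unary c)).mul ?_
    induction k with
    | zero => simpa only [pow_zero] using const (unary 1)
    | succ k ih => simpa only [pow_succ] using ih.mul hr

end PTime

end

section

/-! ### Bit strings -/

section Bits

variable {a b c n m : ℕ}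

@[simp] theorem left_append (x : Bits a) (y : Bits b) : left (Fin.append x y) = x := by
  funext i; simp [left]

@[simp] theorem right_append (x : Bits a) (y : Bits b) : right (Fin.append x y) = y := by
  funext i; simp [right]

@[simp] theorem append_left_right (x : Bits (a + b)) : Fin.append (left x) (right x) = x := by
  funext i
  refine Fin.addCases (fun i => ?_) (fun i => ?_) i <;> simp [left, right]

theorem eq_append_iff {x : Bits (a + b)} {y : Bits a} {z : Bits b} :
    x = Fin.append y z ↔ left x = y ∧ right x = z := by
  constructor
  · rintro rfl; simp
  · rintro ⟨rfl, rfl⟩; simp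

theorem bits_ext_iff {x y : Bits (a + b)} : x = y ↔ left x = left y ∧ right x = right y := by
  rw [← append_left_right y, eq_append_iff]; simp

/-- Splitting a bit string. -/
def splitEquiv (a b : ℕ) : Bits (a + b) ≃ Bits a × Bits b where
  toFun x := (left x, right x)
  invFun p := Fin.append p.1 p.2
  left_inv x := by simp
  right_inv p := by simp

theorem sum_bits_add {M : Type*} [AddCommMonoid M] (f : Bits (a + b) → M) :
    ∑ x, f x = ∑ y : Bits a, ∑ z : Bits b, f (Fin.append y z) := by
  rw [← Fintype.sum_prod_type']
  exact Fintype.sum_equiv (splitEquiv a b) _ _ fun x => by simp [splitEquiv]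

/-- Transport of bit strings along an equality of lengths. -/
def castBits (h : a = b) (x : Bits a) : Bits b := fun i => x (Fin.cast h.symm i)

theorem append_apply (x : Bits a) (y : Bits b) (i : Fin (a + b)) :
    Fin.append x y i = if h : i.val < a then x ⟨i, h⟩ else y ⟨i - a, by omega⟩ := by
  refine Fin.addCases (fun i => ?_) (fun i => ?_) i
  · simp
  · simp

theorem left_apply (x : Bits (a + b)) (i : Fin a) : left x i = x ⟨i, by omega⟩ := rfl

theorem right_apply (x : Bits (a + b)) (i : Fin b) : right x i = x ⟨a + i, by omega⟩ := rfl

theorem castBits_apply (h : a = b) (x : Bits a) (i : Fin b) :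
    castBits h x i = x ⟨i, by omega⟩ := rfl

end Bits

/-! ### The channel of a circuit -/

section Channel

variable {a b c d n m : ℕ}

/-- Transport of operators along an equality of numbers of qubits. -/
def castOp (h : a = b) (ρ : Op a) : Op b := fun x y => ρ (castBits h.symm x) (castBits h.symm y)

/-- Transport of circuits along equalities of numbers of wires. -/
def QCirc.cast (h : a = b) (k : c = d) (C : QCirc a c) : QCirc b d := h ▸ k ▸ C

-- Descriptions do not see the casts of wire numbers, so casts cost nothing in the uniformity
-- proofs.
@[simp] theorem QCirc.code_cast (h : a = b) (k : c = d) (C : QCirc a c) :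
    (C.cast h k).code = C.code := by
  subst h k; rfl

@[simp] theorem castOp_rfl (ρ : Op a) : castOp rfl ρ = ρ := rfl

@[simp] theorem castOp_castOp (h : a = b) (k : b = c) (ρ : Op a) :
    castOp k (castOp h ρ) = castOp (h.trans k) ρ := rfl

theorem run_cast (h : a = b) (k : c = d) (C : QCirc a c) (ρ : Op b) :
    (C.cast h k).run ρ = castOp k (C.run (castOp h.symm ρ)) := by
  subst h k; rfl

theorem QCirc.run_apply (C : QCirc a b) (ρ : Op a) (y y' : Bits b) :
    C.run ρ y y' = ∑ u, ∑ u', C.denote (y, y') (u, u') * ρ u u' := rfl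

theorem QCirc.run_apply' (C : QCirc a b) (ρ : Op a) (y y' : Bits b) :
    C.run ρ y y' = ∑ p : Bits a × Bits a, C.denote (y, y') p * ρ p.1 p.2 := by
  rw [Fintype.sum_prod_type]; rfl

theorem run_sum {ι : Type*} (s : Finset ι) (C : QCirc a b) (ρ : ι → Op a) :
    C.run (∑ i ∈ s, ρ i) = ∑ i ∈ s, C.run (ρ i) := by
  ext y y'
  simp only [QCirc.run_apply', Matrix.sum_apply, Finset.mul_sum]
  exact Finset.sum_comm

theorem run_smul (C : QCirc a b) (r : ℂ) (ρ : Op a) : C.run (r • ρ) = r • C.run ρ := by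
  ext y y'
  simp only [QCirc.run_apply, Matrix.smul_apply, smul_eq_mul, Finset.mul_sum]
  refine Finset.sum_congr rfl fun _ _ => Finset.sum_congr rfl fun _ _ => by ring

theorem run_seq (C : QCirc a b) (D : QCirc b c) (ρ : Op a) :
    (C.seq D).run ρ = D.run (C.run ρ) := by
  ext y y'
  simp only [QCirc.run_apply', QCirc.denote, Matrix.mul_apply, Finset.mul_sum, Finset.sum_mul]
  rw [Finset.sum_comm]
  exact Finset.sum_congr rfl fun _ _ => Finset.sum_congr rfl fun _ _ => mul_assoc _ _ _

theorem run_par (C : QCirc a b) (D : QCirc c d) (ρ : Op a) (σ : Op c) :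
    (C.par D).run (tensorState ρ σ) = tensorState (C.run ρ) (D.run σ) := by
  ext y y'
  simp only [QCirc.run_apply, QCirc.denote, Superop.tensor, tensorState, Matrix.of_apply,
    sum_bits_add, left_append, right_append]
  simp only [Finset.sum_mul_sum]
  exact Finset.sum_congr rfl fun _ _ => Finset.sum_congr rfl fun _ _ =>
    Finset.sum_congr rfl fun _ _ => Finset.sum_congr rfl fun _ _ => by ring

@[simp] theorem run_wires (ρ : Op a) : (QCirc.wires a).run ρ = ρ := by
  ext y y'
  simp [QCirc.run_apply, QCirc.denote, Matrix.one_apply, ite_and]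

/-! ### Trace preservation -/

theorem sum_bits_one {M : Type*} [AddCommMonoid M] (f : Bits 1 → M) :
    ∑ x, f x = f ![false] + f ![true] := by
  rw [← Fintype.sum_equiv (Equiv.funUnique (Fin 1) Bool).symm (fun b => f ![b]) f fun b => by
    congr 1; funext i; fin_cases i; rfl]
  simp [add_comm]

/-- This is trace preservation on the matrix units `|u⟩⟨u'|`, a form that passes directly through
composition and tensor products. -/
theorem sum_denote_diag (C : QCirc a b) :
    ∀ u u', ∑ y, C.denote (y, y) (u, u') = if u = u' then 1 else 0 := by
  -- An injective map of basis states is an isometry; this settles every classical gate, the wire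
  -- swap and the fresh qubit.
  have hconj : ∀ {a b : ℕ} (f : Bits a → Bits b), Function.Injective f → ∀ u u',
      ∑ y, conjBy (classicalMap f) (y, y) (u, u') = if u = u' then 1 else 0 := by
    intro a b f hf u u'
    have h : ∀ y : Bits b, conjBy (classicalMap f) (y, y) (u, u') =
        if y = f u then (if u = u' then 1 else 0) else 0 := fun y => by
      simp only [conjBy, classicalMap, Matrix.of_apply]
      by_cases hy : y = f u
      · subst hy
        by_cases hu : u = u'
        · subst hu; simp
        · simp [hu, hf.ne hu]
      · simp [hy]
    simp [h]
  induction C with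
  | x => exact hconj _ (by decide)
  | h =>
    have h2 : ((Real.sqrt 2 : ℝ) : ℂ)⁻¹ * ((Real.sqrt 2 : ℝ) : ℂ)⁻¹ = 1 / 2 := by
      rw [← mul_inv, ← Complex.ofReal_mul, Real.mul_self_sqrt (by norm_num)]
      norm_num
    intro u u'
    obtain ⟨a, rfl⟩ : ∃ a, u = ![a] := ⟨u 0, by funext i; fin_cases i; rfl⟩
    obtain ⟨b, rfl⟩ : ∃ b, u' = ![b] := ⟨u' 0, by funext i; fin_cases i; rfl⟩
    rw [sum_bits_one]
    cases a <;> cases b <;>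
      simp [QCirc.denote, conjBy, hadamardMatrix, h2] <;> norm_num
  | t =>
    intro u u'
    obtain ⟨a, rfl⟩ : ∃ a, u = ![a] := ⟨u 0, by funext i; fin_cases i; rfl⟩
    obtain ⟨b, rfl⟩ : ∃ b, u' = ![b] := ⟨u' 0, by funext i; fin_cases i; rfl⟩
    rw [sum_bits_one]
    have h2 : Complex.exp (Real.pi / 4 * Complex.I) *
        (starRingEnd ℂ) (Complex.exp (Real.pi / 4 * Complex.I)) = 1 := by
      rw [← Complex.exp_conj, ← Complex.exp_add]
      simp [Complex.conj_ofNat]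
    cases a <;> cases b <;>
      simp [QCirc.denote, conjBy, tMatrix, Matrix.diagonal_apply, h2]
  | cnot => exact hconj _ (by decide)
  | ccnot => exact hconj _ (by decide)
  | init => exact hconj _ (by decide)
  | discard => simp [QCirc.denote, Matrix.of_apply]
  | wires n => 
    intro u u'
    simp [QCirc.denote, Matrix.one_apply, ite_and]
  | swap a b =>
    refine hconj _ fun u v h => ?_
    rw [eq_append_iff] at h
    rw [bits_ext_iff]
    simpa [and_comm] using h
  | seq C D ihC ihD =>
    intro u u'
    simp only [QCirc.denote, Matrix.mul_apply]
    rw [Finset.sum_comm]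
    simp only [← Finset.sum_mul, Fintype.sum_prod_type, ihD]
    simp [ihC]
  | par C D ihC ihD =>
    intro u u'
    simp only [QCirc.denote, Superop.tensor, Matrix.of_apply, sum_bits_add, left_append,
      right_append, ← Finset.sum_mul_sum, ihC, ihD]
    by_cases h : left u = left u' <;> simp [h, bits_ext_iff (x := u)]

theorem trace_run (C : QCirc a b) (ρ : Op a) : (C.run ρ).trace = ρ.trace := by
  simp only [Matrix.trace, Matrix.diag_apply, QCirc.run_apply]
  rw [Finset.sum_comm]
  refine Finset.sum_congr rfl fun u _ => ?_
  rw [Finset.sum_comm]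
  simp [← Finset.sum_mul, sum_denote_diag]

/-! ### Complete positivity -/

/-- The superoperator is completely positive: it has a Kraus decomposition. -/
def HasKraus (S : Superop a b) : Prop :=
  ∃ (ι : Type) (_ : Fintype ι) (K : ι → Matrix (Bits b) (Bits a) ℂ), S = ∑ i, conjBy (K i)

theorem hasKraus_conjBy (K : Matrix (Bits b) (Bits a) ℂ) : HasKraus (conjBy K) :=
  ⟨Unit, inferInstance, fun _ => K, by simp⟩

theorem conjBy_mul (K : Matrix (Bits b) (Bits a) ℂ) (L : Matrix (Bits c) (Bits b) ℂ) :
    conjBy L * conjBy K = conjBy (L * K) := by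
  ext ⟨y, y'⟩ ⟨u, u'⟩
  simp only [conjBy, Matrix.mul_apply, Matrix.of_apply, Fintype.sum_prod_type, star_sum,
    Finset.sum_mul_sum, star_mul']
  exact Finset.sum_congr rfl fun _ _ => Finset.sum_congr rfl fun _ _ => by ring

/-- Positivity alone is not stable under tensor products, so the induction is on Kraus
decompositions: products of Kraus operators serve `seq` and their tensor products serve `par`. -/
theorem hasKraus_denote (C : QCirc a b) : HasKraus C.denote := by
  induction C with
  | x | h | t | cnot | ccnot | init | swap => exact hasKraus_conjBy _
  | discard =>
    -- The partial trace has the bras `⟨x|` as Kraus operators.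
    refine ⟨Bits 1, inferInstance, fun x => Matrix.of fun _ u => if u = x then 1 else 0, ?_⟩
    ext ⟨y, y'⟩ ⟨u, u'⟩
    simp [QCirc.denote, conjBy, Matrix.sum_apply, eq_comm]
  | wires n =>
    refine ⟨Unit, inferInstance, fun _ => 1, ?_⟩
    ext ⟨y, y'⟩ ⟨u, u'⟩
    simp only [QCirc.denote, conjBy, Matrix.sum_apply, Matrix.one_apply, Prod.mk.injEq]
    by_cases h : y = u <;> by_cases h' : y' = u' <;> simp [h, h']
  | seq C D ihC ihD =>
    obtain ⟨ι, _, K, hK⟩ := ihC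
    obtain ⟨κ, _, L, hL⟩ := ihD
    refine ⟨κ × ι, inferInstance, fun i => L i.1 * K i.2, ?_⟩
    simp only [QCirc.denote, hK, hL, Matrix.sum_mul, Matrix.mul_sum, Fintype.sum_prod_type,
      conjBy_mul]
    exact Finset.sum_comm
  | par C D ihC ihD =>
    obtain ⟨ι, _, K, hK⟩ := ihC
    obtain ⟨κ, _, L, hL⟩ := ihD
    refine ⟨ι × κ, inferInstance, fun i => Matrix.of fun y u =>
      K i.1 (left y) (left u) * L i.2 (right y) (right u), ?_⟩
    ext ⟨y, y'⟩ ⟨u, u'⟩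
    simp only [QCirc.denote, hK, hL, Superop.tensor, Matrix.of_apply, Matrix.sum_apply, conjBy,
      Finset.sum_mul_sum, Fintype.sum_prod_type, star_mul']
    exact Finset.sum_congr rfl fun _ _ => Finset.sum_congr rfl fun _ _ => by ring

open scoped ComplexOrder

theorem posSemidef_run (C : QCirc a b) {ρ : Op a} (hρ : ρ.PosSemidef) : (C.run ρ).PosSemidef := by
  obtain ⟨ι, _, K, hK⟩ := hasKraus_denote C
  have : C.run ρ = ∑ i, K i * ρ * (K i).conjTranspose := by
    ext y y'
    simp only [QCirc.run_apply, hK, Matrix.sum_apply, conjBy, Matrix.of_apply, Matrix.mul_apply,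
      Finset.sum_mul, Matrix.conjTranspose_apply]
    rw [Finset.sum_congr rfl fun _ _ => Finset.sum_comm, Finset.sum_comm]
    refine Finset.sum_congr rfl fun _ _ => ?_
    rw [Finset.sum_comm]
    exact Finset.sum_congr rfl fun _ _ => Finset.sum_congr rfl fun _ _ => by ring
  rw [this]
  exact Matrix.posSemidef_sum _ fun i _ => hρ.mul_mul_conjTranspose_same _

theorem posSemidef_castOp (h : a = b) {ρ : Op a} (hρ : ρ.PosSemidef) :
    (castOp h ρ).PosSemidef := by
  subst h; exact hρ

theorem posSemidef_tensorState {ρ : Op a} {σ : Op b} (hρ : ρ.PosSemidef) (hσ : σ.PosSemidef) :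
    (tensorState ρ σ).PosSemidef :=
  (hρ.kronecker hσ).submatrix fun x => (left x, right x)

theorem posSemidef_ket (x : Bits a) : (ket x).PosSemidef := by
  have : ket x = Matrix.diagonal (Pi.single x 1) := by
    rw [Matrix.diagonal_single]; rfl
  rw [this, Matrix.posSemidef_diagonal_iff]
  intro i
  by_cases h : i = x
  · subst h; simp
  · simp [h]

theorem posSemidef_afterMeasuring {ρ : Op (a + b)} (hρ : ρ.PosSemidef) (x : Bits a) :
    (afterMeasuring ρ x).PosSemidef :=
  hρ.submatrix _

theorem prob_nonneg {ρ : Op a} (hρ : ρ.PosSemidef) (x : Bits a) : 0 ≤ prob ρ x :=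
  (Complex.le_def.1 (hρ.diag_nonneg (i := x))).1

/-- `prob` is only a real part; positivity shows that nothing is lost, so diagonal entries can be
used as complex weights. -/
theorem apply_eq_prob {ρ : Op a} (hρ : ρ.PosSemidef) (x : Bits a) : ρ x x = (prob ρ x : ℂ) := by
  have := (Complex.le_def.1 (hρ.diag_nonneg (i := x))).2
  exact Complex.ext rfl (by simpa using this.symm)

theorem sum_prob (ρ : Op a) : ∑ x, prob ρ x = ρ.trace.re := by
  simp [prob, Matrix.trace]

theorem prob_sum {ι : Type*} (s : Finset ι) (ρ : ι → Op a) (x : Bits a) :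
    prob (∑ i ∈ s, ρ i) x = ∑ i ∈ s, prob (ρ i) x := by
  simp [prob, Matrix.sum_apply]

theorem prob_smul (r : ℝ) (ρ : Op a) (x : Bits a) :
    prob ((r : ℂ) • ρ) x = r * prob ρ x := by
  simp [prob]

/-! ### Product states -/

theorem trace_tensorState (ρ : Op a) (σ : Op b) :
    (tensorState ρ σ).trace = ρ.trace * σ.trace := by
  simp [Matrix.trace, tensorState, sum_bits_add, Finset.sum_mul_sum]

@[simp] theorem trace_ket (x : Bits a) : (ket x).trace = 1 := by
  simp [ket, Matrix.trace_single_eq_same]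

theorem ket_apply (x y y' : Bits a) : ket x y y' = if y = x ∧ y' = x then 1 else 0 := by
  simp [ket, Matrix.single_apply, eq_comm]

theorem tensorState_ket (x : Bits a) (y : Bits b) :
    tensorState (ket x) (ket y) = ket (Fin.append x y) := by
  ext z z'
  simp only [tensorState, Matrix.of_apply, ket_apply, eq_append_iff]
  split_ifs <;> simp_all

theorem tensorState_assoc (ρ : Op a) (σ : Op b) (τ : Op c) :
    castOp (Nat.add_assoc a b c) (tensorState (tensorState ρ σ) τ) =
      tensorState ρ (tensorState σ τ) := by
  ext x y
  have h1 : ∀ z : Bits (a + (b + c)), left (left (castBits (Nat.add_assoc a b c).symm z)) = left z :=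
    fun z => rfl
  have h2 : ∀ z : Bits (a + (b + c)),
      right (left (castBits (Nat.add_assoc a b c).symm z)) = left (right z) := fun z => rfl
  have h3 : ∀ z : Bits (a + (b + c)),
      right (castBits (Nat.add_assoc a b c).symm z) = right (right z) := fun z => by
    funext i
    simp only [right_apply, castBits_apply]
    congr 2
    omega
  simp only [castOp, tensorState, Matrix.of_apply, h1, h2, h3, mul_assoc]

theorem tensorState_assoc' (ρ : Op a) (σ : Op b) (τ : Op c) :
    castOp (Nat.add_assoc a b c).symm (tensorState ρ (tensorState σ τ)) =
      tensorState (tensorState ρ σ) τ := by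
  rw [← tensorState_assoc]; simp

theorem tensorState_sum_left {ι : Type*} (s : Finset ι) (ρ : ι → Op a) (σ : Op b) :
    tensorState (∑ i ∈ s, ρ i) σ = ∑ i ∈ s, tensorState (ρ i) σ := by
  ext x y
  simp [tensorState, Matrix.sum_apply, Finset.sum_mul]

theorem tensorState_sum_right {ι : Type*} (s : Finset ι) (ρ : Op a) (σ : ι → Op b) :
    tensorState ρ (∑ i ∈ s, σ i) = ∑ i ∈ s, tensorState ρ (σ i) := by
  ext x y
  simp [tensorState, Matrix.sum_apply, Finset.mul_sum]

theorem tensorState_smul_left (r : ℂ) (ρ : Op a) (σ : Op b) :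
    tensorState (r • ρ) σ = r • tensorState ρ σ := by
  ext x y
  simp [tensorState, mul_assoc]

theorem tensorState_smul_right (r : ℂ) (ρ : Op a) (σ : Op b) :
    tensorState ρ (r • σ) = r • tensorState ρ σ := by
  ext x y
  simp [tensorState, mul_left_comm]

/-- The state of no qubits is a right unit. -/
theorem tensorState_one (ρ : Op a) : tensorState ρ (1 : Op 0) = ρ := by
  ext x y
  have h : (1 : Op 0) (right x) (right y) = 1 := by
    rw [Subsingleton.elim (right x) (right y), Matrix.one_apply_eq]
  simp only [tensorState, Matrix.of_apply, h, mul_one]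
  rfl

theorem copies_zero (ρ : Op m) : copies 0 ρ = castOp (Nat.zero_mul m).symm 1 := by
  ext x y
  simp only [copies, castOp, Matrix.of_apply, Finset.univ_eq_empty, Finset.prod_empty]
  rw [Subsingleton.elim (castBits (Nat.zero_mul m) x) (castBits (Nat.zero_mul m) y),
    Matrix.one_apply_eq]

/-- `finProdFinEquiv` lays the copies out as consecutive blocks, so the last factor occupies the
last `m` positions and the cast moves no bit. -/
theorem copies_succ (t : ℕ) (ρ : Op m) :
    copies (t + 1) ρ = castOp (Nat.succ_mul t m).symm (tensorState (copies t ρ) ρ) := by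
  ext x y
  simp only [copies, castOp, tensorState, Matrix.of_apply, Fin.prod_univ_castSucc]
  congr 1
  congr 1 <;> funext j <;> simp only [right_apply, castBits_apply] <;> congr 1 <;>
    ext <;> simp [finProdFinEquiv] <;> ring

theorem posSemidef_copies (t : ℕ) {ρ : Op m} (hρ : ρ.PosSemidef) : (copies t ρ).PosSemidef := by
  induction t with
  | zero => rw [copies_zero]; exact posSemidef_castOp _ Matrix.PosSemidef.one
  | succ t ih => rw [copies_succ]; exact posSemidef_castOp _ (posSemidef_tensorState ih hρ)

end Channel

end

section

variable {a b c d n m l : ℕ}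

/-! ### Circuits that act classically -/

open Classical in
/-- The circuit computes `f` reversibly and discards data that agree on `u` and `u'` exactly
when `r u u'`. -/
def Implements (C : QCirc a b) (f : Bits a → Bits b) (r : Bits a → Bits a → Prop) : Prop :=
  ∀ y y' u u', C.denote (y, y') (u, u') = if y = f u ∧ y' = f u' ∧ r u u' then 1 else 0

namespace Implements

theorem of_conjBy {C : QCirc a b} {f : Bits a → Bits b} (h : C.denote = conjBy (classicalMap f)) :
    Implements C f fun _ _ => True := by
  intro y y' u u'
  simp only [h, conjBy, classicalMap, Matrix.of_apply]
  by_cases h : y = f u <;> by_cases h' : y' = f u' <;> simp [h, h']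

theorem wires : Implements (.wires n) id fun _ _ => True := by
  intro y y' u u'
  simp [QCirc.denote, Matrix.one_apply]

theorem discard : Implements .discard (fun _ => default) fun u u' => u = u' := by
  intro y y' u u'
  obtain rfl : y = default := Subsingleton.elim _ _
  obtain rfl : y' = default := Subsingleton.elim _ _
  simp only [QCirc.denote, Matrix.of_apply, true_and]

theorem x : Implements .x (fun u => ![!(u 0)]) fun _ _ => True := of_conjBy rfl

theorem cnot : Implements .cnot (fun u => ![u 0, xor (u 1) (u 0)]) fun _ _ => True :=
  of_conjBy rfl

theorem ccnot : Implements .ccnot (fun u => ![u 0, u 1, xor (u 2) (u 0 && u 1)])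
    fun _ _ => True :=
  of_conjBy rfl

theorem init : Implements .init (fun _ => ![false]) fun _ _ => True := of_conjBy rfl

theorem swap : Implements (.swap a b) (fun u => Fin.append (right u) (left u))
    fun _ _ => True :=
  of_conjBy rfl

/-- The sum over intermediate matrix units has the single term `(f u, f u')`. The second circuit
discards data of `f u`, so coherence between `u` and `u'` survives only if both discarded records
agree. -/
theorem seq {C : QCirc a b} {D : QCirc b c} {f g r s} (hC : Implements C f r)
    (hD : Implements D g s) :
    Implements (C.seq D) (g ∘ f) fun u u' => r u u' ∧ s (f u) (f u') := by
  intro y y' u u'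
  simp only [QCirc.denote, Matrix.mul_apply, Fintype.sum_prod_type]
  rw [Finset.sum_eq_single (f u), Finset.sum_eq_single (f u'), hC, hD]
  · simp only [true_and, Function.comp_apply, mul_ite, mul_one, mul_zero]
    split_ifs <;> simp_all
  · intro z _ hz
    simp [hC _ z, hz]
  · simp
  · intro z _ hz
    exact Finset.sum_eq_zero fun z' _ => by simp [hC z, hz]
  · simp

theorem par {C : QCirc a b} {D : QCirc c d} {f g r s} (hC : Implements C f r)
    (hD : Implements D g s) :
    Implements (C.par D) (fun u => Fin.append (f (left u)) (g (right u)))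
      fun u u' => r (left u) (left u') ∧ s (right u) (right u') := by
  intro y y' u u'
  simp only [QCirc.denote, Superop.tensor, Matrix.of_apply]
  have h : (y = Fin.append (f (left u)) (g (right u)) ∧
      y' = Fin.append (f (left u')) (g (right u')) ∧
        r (left u) (left u') ∧ s (right u) (right u')) ↔
      (left y = f (left u) ∧ left y' = f (left u') ∧ r (left u) (left u')) ∧
        right y = g (right u) ∧ right y' = g (right u') ∧ s (right u) (right u') := by
    rw [eq_append_iff, eq_append_iff]
    tauto
  rw [hC, hD]
  by_cases h1 : left y = f (left u) ∧ left y' = f (left u') ∧ r (left u) (left u')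
  · by_cases h2 : right y = g (right u) ∧ right y' = g (right u') ∧ s (right u) (right u')
    · rw [if_pos h1, if_pos h2, if_pos (h.2 ⟨h1, h2⟩), one_mul]
    · rw [if_neg h2, if_neg fun hh => h2 (h.1 hh).2, mul_zero]
  · rw [if_neg h1, if_neg fun hh => h1 (h.1 hh).1, zero_mul]

theorem congr {C : QCirc a b} {f g : Bits a → Bits b} {r s : Bits a → Bits a → Prop}
    (h : Implements C f r) (hf : ∀ u, f u = g u) (hr : ∀ u u', r u u' ↔ s u u') :
    Implements C g s := by
  obtain rfl : f = g := funext hf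
  obtain rfl : r = s := by ext u u'; exact hr u u'
  exact h

theorem run_ket {C : QCirc a b} {f : Bits a → Bits b} {r : Bits a → Bits a → Prop}
    (h : Implements C f r) {x : Bits a} (hx : r x x) : C.run (ket x) = ket (f x) := by
  ext y y'
  rw [QCirc.run_apply, Finset.sum_eq_single x, Finset.sum_eq_single x, h]
  · simp [ket_apply, hx]
  · intro z _ hz
    simp [ket_apply, hz]
  · simp
  · intro z _ hz
    simp [ket_apply, hz]
  · simp

/-- A bijection that discards nothing relabels the basis, which determines the output on every
operator and not only on basis states. -/
theorem run_of_inverse {C : QCirc a b} {f : Bits a → Bits b} {g : Bits b → Bits a}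
    (h : Implements C f fun _ _ => True) (hg : ∀ y u, y = f u ↔ u = g y) (ρ : Op a)
    (y y' : Bits b) : C.run ρ y y' = ρ (g y) (g y') := by
  simp [QCirc.run_apply, h y y', hg, ite_and]

end Implements

theorem run_swap (ρ : Op a) (σ : Op b) :
    (QCirc.swap a b).run (tensorState ρ σ) = tensorState σ ρ := by
  ext y y'
  rw [Implements.swap.run_of_inverse (g := fun y => Fin.append (right y) (left y))]
  · simp [tensorState, mul_comm]
  · intro y u
    rw [eq_append_iff, eq_append_iff, and_comm]
    constructor <;> exact fun h => ⟨h.1.symm, h.2.symm⟩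

/-! ### Rearrangement of registers -/

namespace QCirc

/-- Reassociation of three registers. -/
def assocL (a b c : ℕ) : QCirc (a + (b + c)) (a + b + c) :=
  (wires (a + b + c)).cast (Nat.add_assoc a b c) rfl

/-- Reassociation of three registers. -/
def assocR (a b c : ℕ) : QCirc (a + b + c) (a + (b + c)) :=
  (wires (a + b + c)).cast rfl (Nat.add_assoc a b c)

/-- Exchange of the two registers in the middle. -/
def middle (a b c d : ℕ) : QCirc (a + b + (c + d)) (a + c + (b + d)) :=
  (assocR a b (c + d)).seq
    (((wires a).par ((assocL b c d).seq (((swap b c).par (wires d)).seq (assocR c b d)))).seq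
      (assocL a c (b + d)))

/-- Exchange of the first two registers. -/
def leftComm (a b c : ℕ) : QCirc (a + (b + c)) (b + (a + c)) :=
  (assocL a b c).seq (((swap a b).par (wires c)).seq (assocR b a c))

/-- Splitting off the last of `n + 1` blocks of `m` wires. -/
def unfold (n m : ℕ) : QCirc ((n + 1) * m) (n * m + m) :=
  (wires (n * m + m)).cast (Nat.succ_mul n m).symm rfl

/-- Joining a block of `m` wires to `n` blocks. -/
def fold (n m : ℕ) : QCirc (n * m + m) ((n + 1) * m) :=
  (wires (n * m + m)).cast rfl (Nat.succ_mul n m).symm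

end QCirc

open QCirc

theorem run_assocL (ρ : Op a) (σ : Op b) (τ : Op c) :
    (assocL a b c).run (tensorState ρ (tensorState σ τ)) = tensorState (tensorState ρ σ) τ := by
  rw [assocL, run_cast, run_wires, castOp_rfl, tensorState_assoc']

theorem run_assocR (ρ : Op a) (σ : Op b) (τ : Op c) :
    (assocR a b c).run (tensorState (tensorState ρ σ) τ) = tensorState ρ (tensorState σ τ) := by
  rw [assocR, run_cast, run_wires, castOp_rfl, tensorState_assoc]

theorem run_middle (ρ : Op a) (σ : Op b) (τ : Op c) (υ : Op d) :
    (middle a b c d).run (tensorState (tensorState ρ σ) (tensorState τ υ)) =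
      tensorState (tensorState ρ τ) (tensorState σ υ) := by
  simp only [middle, run_seq, run_par, run_wires, run_assocL, run_assocR, run_swap]

theorem run_leftComm (ρ : Op a) (σ : Op b) (τ : Op c) :
    (leftComm a b c).run (tensorState ρ (tensorState σ τ)) =
      tensorState σ (tensorState ρ τ) := by
  simp only [leftComm, run_seq, run_par, run_wires, run_assocL, run_assocR, run_swap]

theorem run_unfold (ρ : Op m) :
    (unfold n m).run (copies (n + 1) ρ) = tensorState (copies n ρ) ρ := by
  rw [unfold, run_cast, run_wires, copies_succ, castOp_castOp, castOp_castOp, castOp_rfl]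

theorem run_fold (ρ : Op m) :
    (fold n m).run (tensorState (copies n ρ) ρ) = copies (n + 1) ρ := by
  rw [fold, run_cast, run_wires, copies_succ, castOp_rfl]

/-! ### Creating and discarding registers -/

theorem eq_trace_smul_one (ρ : Op 0) : ρ = ρ.trace • 1 := by
  ext x y
  obtain rfl : x = default := Subsingleton.elim _ _
  obtain rfl : y = default := Subsingleton.elim _ _
  rw [Matrix.trace, Fintype.sum_unique, Matrix.smul_apply, Matrix.one_apply_eq, smul_eq_mul,
    mul_one, Matrix.diag_apply]
  exact congrArg₂ ρ (Subsingleton.elim _ _) (Subsingleton.elim _ _)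

namespace QCirc

/-- A register of `n` qubits, each produced by `C`. -/
def createN (C : QCirc 0 1) : (n : ℕ) → QCirc 0 n
  | 0 => wires 0
  -- The outer identity wires do nothing; they give the recursion the common shape demanded by
  -- `code_recursion`.
  | n + 1 => (wires 0).seq (((createN C n).par C).seq (wires (n + 1)))

/-- The circuit `C` on each of `n` qubits. -/
def mapN (C : QCirc 1 1) : (n : ℕ) → QCirc n n
  | 0 => wires 0
  | n + 1 => (wires (n + 1)).seq (((mapN C n).par C).seq (wires (n + 1)))

/-- Discarding `n` qubits. -/
def discardN : (n : ℕ) → QCirc n 0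
  | 0 => wires 0
  | n + 1 => (wires (n + 1)).seq (((discardN n).par discard).seq (wires 0))

/-- Appending a register of zeros. -/
def zeros (n l : ℕ) : QCirc n (n + l) := (wires n).par (createN init l)

/-- Appending a register of ones. -/
def ones (n l : ℕ) : QCirc n (n + l) := (wires n).par (createN (init.seq x) l)

/-- Discarding the first register. -/
def dropLeft (a b : ℕ) : QCirc (a + b) b := (swap a b).seq ((wires b).par (discardN a))

/-- A copy of a qubit in the computational basis. -/
def copyOne : QCirc 1 (1 + 1) := ((wires 1).par init).seq cnot

/-- Measurement of `n` qubits in the computational basis. -/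
def dephase (n : ℕ) : QCirc n n := mapN (copyOne.seq ((wires 1).par discard)) n

/-- A copy of a register in the computational basis. -/
def copy : (n : ℕ) → QCirc n (n + n)
  | 0 => wires 0
  | n + 1 => (wires (n + 1)).seq (((copy n).par copyOne).seq (middle n n 1 1))

end QCirc

/-- A circuit without inputs acts on the unit of no qubits, and `n + 0` is `n` by definition, so no
cast appears. -/
theorem run_par_of_zero (C : QCirc 0 l) (ρ : Op n) :
    ((wires n).par C).run ρ = tensorState ρ (C.run 1) := by
  have h := run_par (wires n) C ρ 1
  rwa [tensorState_one, run_wires] at h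

theorem append_const (v : Bool) : Fin.append (fun _ : Fin a => v) (fun _ : Fin b => v) =
    fun _ => v := by
  funext i
  rw [append_apply]
  split_ifs <;> rfl

theorem one_eq_ket (x : Bits 0) : (1 : Op 0) = ket x := by
  ext y y'
  rw [Subsingleton.elim y x, Subsingleton.elim y' x]
  simp [ket_apply]

theorem run_createN {C : QCirc 0 1} {v : Bool} (hC : C.run 1 = ket fun _ => v) (n : ℕ) :
    (createN C n).run 1 = ket fun _ => v := by
  induction n with
  | zero => rw [createN, run_wires, one_eq_ket]
  | succ n ih =>
    have h := run_par (createN C n) C 1 1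
    rw [tensorState_one, ih, hC, tensorState_ket, append_const] at h
    rw [createN, run_seq, run_seq, run_wires, run_wires]
    exact h

theorem run_init : QCirc.init.run 1 = ket fun _ => false := by
  rw [one_eq_ket default, Implements.init.run_ket trivial]
  congr 1
  funext i; fin_cases i; rfl

theorem run_zeros (ρ : Op n) : (zeros n l).run ρ = tensorState ρ (ket fun _ => false) := by
  rw [zeros, run_par_of_zero, run_createN run_init]

theorem run_ones (ρ : Op n) : (ones n l).run ρ = tensorState ρ (ket fun _ => true) := by
  rw [ones, run_par_of_zero, run_createN]
  rw [run_seq, run_init, Implements.x.run_ket trivial]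
  congr 1
  funext i; fin_cases i; rfl

theorem implements_discardN (n : ℕ) :
    Implements (discardN n) (fun _ => default) fun u u' => u = u' := by
  induction n with
  | zero =>
    exact Implements.wires.congr (fun _ => Subsingleton.elim _ _) fun u u' =>
      ⟨fun _ => Subsingleton.elim _ _, fun _ => trivial⟩
  | succ n ih =>
    refine (Implements.wires.seq ((ih.par .discard).seq .wires)).congr
      (fun _ => Subsingleton.elim (α := Bits 0) _ _) fun u u' => ?_
    simp [bits_ext_iff (x := u)]

theorem implements_dropLeft (a b : ℕ) :
    Implements (dropLeft a b) right fun u u' => left u = left u' := by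
  refine (Implements.swap.seq (Implements.wires.par (implements_discardN a))).congr
    (fun u => ?_) fun u u' => ?_
  · refine (eq_append_iff.2 ⟨?_, Subsingleton.elim _ _⟩).symm
    simp
    rfl
  · simp

theorem run_dropLeft (ρ : Op (a + b)) : (dropLeft a b).run ρ = ∑ x, afterMeasuring ρ x := by
  ext y y'
  simp only [QCirc.run_apply, implements_dropLeft a b y y', sum_bits_add, left_append,
    right_append, Matrix.sum_apply, afterMeasuring, Matrix.of_apply]
  refine Finset.sum_congr rfl fun x _ => ?_
  simp [ite_and]

theorem run_dropLeft_tensorState (ρ : Op a) (σ : Op b) :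
    (dropLeft a b).run (tensorState ρ σ) = ρ.trace • σ := by
  rw [run_dropLeft]
  ext y y'
  simp [afterMeasuring, tensorState, Matrix.sum_apply, Matrix.trace, Finset.sum_mul]

theorem afterMeasuring_tensorState_ket (x y : Bits a) (ρ : Op b) :
    afterMeasuring (tensorState (ket x) ρ) y = if y = x then ρ else 0 := by
  ext z z'
  by_cases h : y = x <;> simp [afterMeasuring, tensorState, ket_apply, h]

/-! ### Copying and measuring -/

theorem implements_copyOne : Implements copyOne (fun u => ![u 0, u 0]) fun _ _ => True := by
  refine ((Implements.wires.par .init).seq .cnot).congr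
    (fun u => ?_) (by simp)
  funext i
  fin_cases i <;> simp [append_apply, left_apply]

theorem implements_dephase (n : ℕ) : Implements (dephase n) id fun u u' => u = u' := by
  have h1 : Implements (copyOne.seq ((wires 1).par discard)) id fun u u' => u = u' := by
    refine (implements_copyOne.seq (Implements.wires.par .discard)).congr (fun u => ?_)
      fun u u' => ?_
    · funext i
      fin_cases i
      simp [append_apply, left_apply]
    · rw [funext_iff, funext_iff]
      simp [right_apply]
  rw [dephase]
  induction n with
  | zero =>
    exact Implements.wires.congr (fun _ => rfl) fun u u' =>
      ⟨fun _ => Subsingleton.elim _ _, fun _ => trivial⟩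
  | succ n ih =>
    refine (Implements.wires.seq ((ih.par h1).seq .wires)).congr (fun u => ?_) fun u u' => ?_
    · simp
    · simp [bits_ext_iff (x := u)]

theorem run_dephase (ρ : Op n) : (dephase n).run ρ = ∑ x, ρ x x • ket x := by
  ext y y'
  have h : ∀ u u', (dephase n).denote (y, y') (u, u') * ρ u u' =
      if u' = u then (ρ u u * if y = u ∧ y' = u then 1 else 0) else 0 := by
    intro u u'
    rw [implements_dephase]
    by_cases h : u' = u
    · subst h
      simp [mul_comm]
    · have h' : ¬ u = u' := fun h' => h h'.symm
      simp [h, h']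
  simp [QCirc.run_apply, h, Matrix.sum_apply, ket_apply]

theorem run_copyOne (x : Bits 1) :
    copyOne.run (ket x) = tensorState (ket x) (ket x) := by
  rw [implements_copyOne.run_ket trivial, tensorState_ket]
  congr 1
  funext i
  fin_cases i <;> simp [append_apply]

/-- Fanning out by CNOT duplicates basis states only; a superposition would become entangled. Keys
are therefore measured before they are copied. -/
theorem run_copy (x : Bits n) : (copy n).run (ket x) = tensorState (ket x) (ket x) := by
  induction n with
  | zero => rw [copy, run_wires, ← one_eq_ket, tensorState_one]
  | succ n ih =>
    obtain ⟨y, z, rfl⟩ : ∃ (y : Bits n) (z : Bits 1), x = Fin.append y z :=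
      ⟨left x, right x, (append_left_right x).symm⟩
    rw [copy, run_seq, run_seq, run_wires, ← tensorState_ket, run_par, ih, run_copyOne, run_middle]

/-! ### Selecting one of two registers -/

/-- Operators on two registers are sums of products. -/
theorem exists_sum_tensorState (ρ : Op (a + b)) :
    ∃ (σ : Bits (a + b) × Bits (a + b) → Op a) (τ : Bits (a + b) × Bits (a + b) → Op b),
      ρ = ∑ i, tensorState (σ i) (τ i) := by
  refine ⟨fun i => ρ i.1 i.2 • Matrix.single (left i.1) (left i.2) 1,
    fun i => Matrix.single (right i.1) (right i.2) 1, ?_⟩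
  ext x y
  have : ∀ u v, tensorState (ρ u v • Matrix.single (left u) (left v) 1)
      (Matrix.single (right u) (right v) 1) x y =
      if u = x then (if v = y then ρ u v else 0) else 0 := by
    intro u v
    simp only [tensorState, Matrix.of_apply, Matrix.smul_apply, Matrix.single_apply,
      bits_ext_iff (x := u), bits_ext_iff (x := v)]
    split_ifs <;> simp_all
  simp only [Matrix.sum_apply, Fintype.sum_prod_type, this]
  simp

namespace QCirc

/-- On one control qubit and two further qubits: exchange of the two if the control is set. -/
def cswap : QCirc (1 + (1 + 1)) (1 + (1 + 1)) :=
  -- This is the Fredkin gate as CNOT, Toffoli, CNOT; the inner swaps bring the XOR of the two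
  -- qubits into the second control position of the Toffoli gate.
  ((wires 1).par cnot).seq (((wires 1).par (swap 1 1)).seq (ccnot.seq
    (((wires 1).par (swap 1 1)).seq ((wires 1).par cnot))))

/-- On one control qubit and two further qubits: discard the one that is not selected. -/
def muxOne : QCirc (1 + (1 + 1)) (1 + 1) :=
  cswap.seq ((wires 1).par ((swap 1 1).seq (dropLeft 1 1)))

/-- On one control qubit and two registers: discard the register that is not selected. -/
def muxCtl : (n : ℕ) → QCirc (1 + (n + n)) (1 + n)
  | 0 => wires 1
  | n + 1 => (((wires 1).par (middle n 1 n 1)).seq (assocL 1 (n + n) (1 + 1))).seq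
      (((muxCtl n).par (wires (1 + 1))).seq
        (((swap 1 n).par (wires (1 + 1))).seq ((assocR n 1 (1 + 1)).seq
          (((wires n).par muxOne).seq (leftComm n 1 1)))))

/-- Selection of one of two registers by a control qubit. -/
def mux (n : ℕ) : QCirc (n + n + 1) n :=
  (swap (n + n) 1).seq ((muxCtl n).seq (dropLeft 1 n))

end QCirc

/-- Conditional exchange of two bits, on bit strings. -/
def cswapBits (u : Bits 3) : Bits 3 := ![u 0, bif u 0 then u 2 else u 1, bif u 0 then u 1 else u 2]

theorem implements_cswap : Implements cswap cswapBits fun _ _ => True := by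
  have hw := Implements.wires (n := 1)
  refine ((hw.par .cnot).seq ((hw.par .swap).seq
    (Implements.ccnot.seq ((hw.par .swap).seq (hw.par .cnot))))).congr (fun u => ?_) (by simp)
  obtain ⟨a, b, c, rfl⟩ : ∃ a b c, u = ![a, b, c] :=
    ⟨u 0, u 1, u 2, by funext i; fin_cases i <;> rfl⟩
  revert a b c
  decide

theorem run_cswap (v : Bool) (ρ σ : Op 1) :
    cswap.run (tensorState (ket fun _ => v) (tensorState ρ σ)) =
      tensorState (ket fun _ => v) (bif v then tensorState σ ρ else tensorState ρ σ) := by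
  ext y y'
  -- The conditional exchange is its own inverse.
  rw [implements_cswap.run_of_inverse (g := cswapBits) (by decide)]
  obtain ⟨a, b, c, rfl⟩ : ∃ a b c, y = ![a, b, c] :=
    ⟨y 0, y 1, y 2, by funext i; fin_cases i <;> rfl⟩
  obtain ⟨a', b', c', rfl⟩ : ∃ a b c, y' = ![a, b, c] :=
    ⟨y' 0, y' 1, y' 2, by funext i; fin_cases i <;> rfl⟩
  have hl : ∀ a b c : Bool, left (a := 1) (b := 1 + 1) ![a, b, c] = ![a] := by decide
  have hr : ∀ a b c : Bool, right (a := 1) (b := 1 + 1) ![a, b, c] = ![b, c] := by decide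
  have hl' : ∀ b c : Bool, left (a := 1) (b := 1) ![b, c] = ![b] := by decide
  have hr' : ∀ b c : Bool, right (a := 1) (b := 1) ![b, c] = ![c] := by decide
  have hv : ∀ a : Bool, ![a] = (fun _ => v : Bits 1) ↔ a = v := by decide +revert
  cases v <;> cases a <;> cases a' <;>
    simp [cswapBits, tensorState, ket_apply, hl, hr, hl', hr', hv, mul_comm]

theorem run_muxOne (v : Bool) (ρ σ : Op 1) :
    muxOne.run (tensorState (ket fun _ => v) (tensorState ρ σ)) =
      (bif v then ρ.trace else σ.trace) •
        tensorState (ket fun _ => v) (bif v then σ else ρ) := by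
  cases v <;> simp only [muxOne, run_seq, run_cswap, run_par, run_wires, cond_true, cond_false,
    run_swap, run_dropLeft_tensorState, tensorState_smul_right]

/-- The induction splits off the last qubit of each register. Registers may be entangled internally,
so the step is made for product operators and extended bilinearly; keeping the trace of the
discarded register as a factor is what makes the formula bilinear. -/
theorem run_muxCtl (v : Bool) (ρ σ : Op n) :
    (muxCtl n).run (tensorState (ket fun _ => v) (tensorState ρ σ)) =
      (bif v then ρ.trace else σ.trace) •
        tensorState (ket fun _ => v) (bif v then σ else ρ) := by
  induction n with
  | zero =>
    rw [eq_trace_smul_one ρ, eq_trace_smul_one σ]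
    cases v <;> simp [tensorState_smul_right, muxCtl, run_smul, run_wires,
      tensorState_one, smul_smul, mul_comm]
  | succ n ih =>
    obtain ⟨α, β, rfl⟩ := exists_sum_tensorState ρ
    obtain ⟨γ, δ, rfl⟩ := exists_sum_tensorState σ
    have key : ∀ (α γ : Op n) (β δ : Op 1), (muxCtl (n + 1)).run
        (tensorState (ket fun _ => v) (tensorState (tensorState α β) (tensorState γ δ))) =
        (bif v then (tensorState α β).trace else (tensorState γ δ).trace) •
          tensorState (ket fun _ => v) (bif v then tensorState γ δ else tensorState α β) := by
      intro α γ β δ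
      simp only [muxCtl, run_seq, run_par, run_wires, run_assocL, run_assocR, run_swap,
        run_middle, ih, run_muxOne, run_leftComm, run_smul, tensorState_smul_left,
        tensorState_smul_right, smul_smul, trace_tensorState]
      cases v <;> simp
    cases v <;> simp only [tensorState_sum_left, tensorState_sum_right, run_sum, key,
      Matrix.trace_sum, Finset.sum_smul, Finset.smul_sum, cond_true, cond_false]
    exact Finset.sum_comm

theorem run_mux (v : Bool) (ρ σ : Op n) :
    (mux n).run (tensorState (tensorState ρ σ) (ket fun _ => v)) =
      (bif v then ρ.trace else σ.trace) • (bif v then σ else ρ) := by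
  simp only [mux, run_seq, run_swap, run_muxCtl, run_smul, run_dropLeft_tensorState, trace_ket,
    one_smul]

/-! ### Interleaving copies -/

namespace QCirc

/-- Rearranging `n` copies of a state and `n` copies of another one into `n` copies of the pair. -/
def interleave (m : ℕ) : (n : ℕ) → QCirc (n * m + n * m) (n * (m + m))
  | 0 => (wires 0).cast (by simp) (by simp)
  | n + 1 => (((unfold n m).par (unfold n m)).seq (middle (n * m) m (n * m) m)).seq
      (((interleave m n).par (wires (m + m))).seq (fold n (m + m)))

/-- Producing `n` states from a classical key, which is kept. -/
def generate (C : QCirc a m) : (n : ℕ) → QCirc a (a + n * m)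
  | 0 => (wires a).par ((wires 0).cast rfl (Nat.zero_mul m).symm)
  | n + 1 => (copy a).seq (((generate C n).par C).seq
      ((assocR a (n * m) m).seq ((wires a).par (fold n m))))

end QCirc

theorem run_interleave (ρ σ : Op m) :
    (interleave m n).run (tensorState (copies n ρ) (copies n σ)) =
      copies n (tensorState ρ σ) := by
  induction n with
  | zero =>
    ext x y
    rw [interleave, run_cast, run_wires]
    simp [castOp, tensorState, copies]
  | succ n ih =>
    simp only [interleave, run_seq, run_par, run_wires, run_unfold, run_middle, ih, run_fold]

/-- Each round consumes a basis-state copy of the key, so the key survives for later use; the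
formula is special to classical keys. -/
theorem run_generate (C : QCirc a m) (k : Bits a) :
    (generate C n).run (ket k) = tensorState (ket k) (copies n (C.run (ket k))) := by
  induction n with
  | zero =>
    rw [generate, run_par_of_zero, run_cast, run_wires, copies_zero, castOp_rfl]
  | succ n ih =>
    simp only [generate, run_seq, run_par, run_wires, run_copy, ih, run_assocR, run_fold]

end

section

open BTree

/-! ### Polynomial-time computation of circuit descriptions -/

namespace PTime

variable {α : Type} {e : α → BTree}

section

variable {a b c d m n l : α → ℕ}

theorem seq {C : ∀ x, QCirc (a x) (b x)} {D : ∀ x, QCirc (b x) (c x)}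
    (hC : PTime e fun x => (C x).code) (hD : PTime e fun x => (D x).code) :
    PTime e fun x => ((C x).seq (D x)).code :=
  (const (unary 9)).node (hC.node hD)

theorem par {C : ∀ x, QCirc (a x) (b x)} {D : ∀ x, QCirc (c x) (d x)}
    (hC : PTime e fun x => (C x).code) (hD : PTime e fun x => (D x).code) :
    PTime e fun x => ((C x).par (D x)).code :=
  (const (unary 10)).node (hC.node hD)

theorem wires (ha : PTime e fun x => unary (a x)) : PTime e fun x => (QCirc.wires (a x)).code :=
  (const (unary 7)).node ha

theorem swap (ha : PTime e fun x => unary (a x)) (hb : PTime e fun x => unary (b x)) :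
    PTime e fun x => (QCirc.swap (a x) (b x)).code :=
  (const (unary 8)).node (ha.node hb)

theorem assocL (ha : PTime e fun x => unary (a x)) (hb : PTime e fun x => unary (b x))
    (hc : PTime e fun x => unary (c x)) :
    PTime e fun x => (QCirc.assocL (a x) (b x) (c x)).code := by
  simp only [QCirc.assocL, QCirc.code_cast]
  exact .wires ((ha.add hb).add hc)

theorem assocR (ha : PTime e fun x => unary (a x)) (hb : PTime e fun x => unary (b x))
    (hc : PTime e fun x => unary (c x)) :
    PTime e fun x => (QCirc.assocR (a x) (b x) (c x)).code := by
  simp only [QCirc.assocR, QCirc.code_cast]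
  exact .wires ((ha.add hb).add hc)

theorem middle (ha : PTime e fun x => unary (a x)) (hb : PTime e fun x => unary (b x))
    (hc : PTime e fun x => unary (c x)) (hd : PTime e fun x => unary (d x)) :
    PTime e fun x => (QCirc.middle (a x) (b x) (c x) (d x)).code :=
  .seq (.assocR ha hb (hc.add hd)) (.seq (.par (.wires ha) (.seq (.assocL hb hc hd)
    (.seq (.par (.swap hb hc) (.wires hd)) (.assocR hc hb hd)))) (.assocL ha hc (hb.add hd)))

theorem leftComm (ha : PTime e fun x => unary (a x)) (hb : PTime e fun x => unary (b x))
    (hc : PTime e fun x => unary (c x)) :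
    PTime e fun x => (QCirc.leftComm (a x) (b x) (c x)).code :=
  .seq (.assocL ha hb hc) (.seq (.par (.swap ha hb) (.wires hc)) (.assocR hb ha hc))

theorem fold (hn : PTime e fun x => unary (n x)) (hm : PTime e fun x => unary (m x)) :
    PTime e fun x => (QCirc.fold (n x) (m x)).code := by
  simp only [QCirc.fold, QCirc.code_cast]
  exact .wires ((hn.mul hm).add hm)

theorem unfold (hn : PTime e fun x => unary (n x)) (hm : PTime e fun x => unary (m x)) :
    PTime e fun x => (QCirc.unfold (n x) (m x)).code := by
  simp only [QCirc.unfold, QCirc.code_cast]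
  exact .wires ((hn.mul hm).add hm)

end

/-- Recursive families of circuits in which the previous circuit is put next to another one and
between two further ones. -/
theorem code_recursion {r : α → ℕ} {F P Q R : α → ℕ → BTree}
    (hr : PTime e fun a => unary (r a)) (h0 : PTime e fun a => F a 0)
    (hP : PTime (fun x : α × ℕ => .node (e x.1) (unary x.2)) fun x => P x.1 x.2)
    (hQ : PTime (fun x : α × ℕ => .node (e x.1) (unary x.2)) fun x => Q x.1 x.2)
    (hR : PTime (fun x : α × ℕ => .node (e x.1) (unary x.2)) fun x => R x.1 x.2)
    (hF : ∀ a i, F a (i + 1) = .node (unary 9) (.node (P a i) (.node (unary 9)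
      (.node (.node (unary 10) (.node (F a i) (Q a i))) (R a i))))) :
    PTime e fun a => F a (r a) := by
  have hloop : PTime (fun x : α × ℕ => .node (e x.1) (.node (unary x.2) (F x.1 x.2)))
      fun x => .node (e x.1) (unary x.2) := PTime.id.fst.node PTime.id.snd.fst
  refine recursion_of_growth
    -- One step adds 65 fixed vertices to the data of `P`, `Q` and `R`; `unary 40` alone has 81.
    (D := fun a i => .node (unary 40) (.node (P a i) (.node (Q a i) (R a i))))
    hr h0 ?_ ((const _).node (hP.node (hQ.node hR))) fun a i => ?_
  · simp only [hF]
    exact (const _).node ((hloop.comp hP).node ((const _).node (((const _).node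
      (PTime.id.snd.snd.node (hloop.comp hQ))).node (hloop.comp hR))))
  · simp only [hF, BTree.size, size_unary]
    omega

theorem of_outer {f : α → BTree} (hf : PTime e f) :
    PTime (fun x : α × ℕ => .node (e x.1) (unary x.2)) fun x => f x.1 :=
  PTime.id.fst.comp (hf.reindex Prod.fst)

theorem index : PTime (fun x : α × ℕ => .node (e x.1) (unary x.2)) fun x => unary x.2 :=
  PTime.id.snd

variable {a m n l : α → ℕ}

theorem createN (C : QCirc 0 1) (hn : PTime e fun x => unary (n x)) :
    PTime e fun x => (QCirc.createN C (n x)).code :=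
  code_recursion (F := fun _ i => (QCirc.createN C i).code) hn (const _) (const _) (const _)
    (.wires index.succ) fun _ _ => rfl

theorem mapN (C : QCirc 1 1) (hn : PTime e fun x => unary (n x)) :
    PTime e fun x => (QCirc.mapN C (n x)).code :=
  code_recursion (F := fun _ i => (QCirc.mapN C i).code) hn (const _) (.wires index.succ) (const _)
    (.wires index.succ) fun _ _ => rfl

theorem discardN (hn : PTime e fun x => unary (n x)) :
    PTime e fun x => (QCirc.discardN (n x)).code :=
  code_recursion (F := fun _ i => (QCirc.discardN i).code) hn (const _) (.wires index.succ)
    (const _) (const _) fun _ _ => rfl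

theorem zeros (hn : PTime e fun x => unary (n x)) (hl : PTime e fun x => unary (l x)) :
    PTime e fun x => (QCirc.zeros (n x) (l x)).code :=
  .par (.wires hn) (.createN _ hl)

theorem ones (hn : PTime e fun x => unary (n x)) (hl : PTime e fun x => unary (l x)) :
    PTime e fun x => (QCirc.ones (n x) (l x)).code :=
  .par (.wires hn) (.createN _ hl)

theorem dropLeft (ha : PTime e fun x => unary (a x)) (hn : PTime e fun x => unary (n x)) :
    PTime e fun x => (QCirc.dropLeft (a x) (n x)).code :=
  .seq (.swap ha hn) (.par (.wires hn) (.discardN ha))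

theorem dephase (hn : PTime e fun x => unary (n x)) :
    PTime e fun x => (QCirc.dephase (n x)).code :=
  .mapN _ hn

theorem copy (hn : PTime e fun x => unary (n x)) : PTime e fun x => (QCirc.copy (n x)).code :=
  code_recursion (F := fun _ i => (QCirc.copy i).code) hn (const _) (.wires index.succ) (const _)
    (.middle index index (const _) (const _)) fun _ _ => rfl

theorem mux (hn : PTime e fun x => unary (n x)) : PTime e fun x => (QCirc.mux (n x)).code := by
  have h1 : ∀ {β : Type} {e : β → BTree}, PTime e fun _ => unary 1 := const _
  have h : PTime e fun x => (QCirc.muxCtl (n x)).code :=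
    code_recursion (F := fun _ i => (QCirc.muxCtl i).code)
      (P := fun _ i => (((QCirc.wires 1).par (QCirc.middle i 1 i 1)).seq
        (QCirc.assocL 1 (i + i) (1 + 1))).code)
      (Q := fun _ _ => (QCirc.wires (1 + 1)).code)
      (R := fun _ i => (((QCirc.swap 1 i).par (QCirc.wires (1 + 1))).seq
        ((QCirc.assocR i 1 (1 + 1)).seq (((QCirc.wires i).par QCirc.muxOne).seq
          (QCirc.leftComm i 1 1)))).code) hn (const _)
      (.seq (.par (const _) (.middle index h1 index h1)) (.assocL h1 (index.add index) (const _)))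
      (const _)
      (.seq (.par (.swap h1 index) (const _)) (.seq (.assocR index h1 (const _))
        (.seq (.par (.wires index) (const _)) (.leftComm index h1 h1)))) fun _ _ => rfl
  exact .seq (.swap (hn.add hn) h1) (.seq h (.dropLeft h1 hn))

theorem interleave (hm : PTime e fun x => unary (m x)) (hn : PTime e fun x => unary (n x)) :
    PTime e fun x => (QCirc.interleave (m x) (n x)).code :=
  code_recursion (F := fun x i => (QCirc.interleave (m x) i).code)
    (P := fun x i => (((QCirc.unfold i (m x)).par (QCirc.unfold i (m x))).seq
      (QCirc.middle (i * m x) (m x) (i * m x) (m x))).code) hn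
    (by simpa only [QCirc.interleave, QCirc.code_cast] using const _)
    (.seq (.par (.unfold index (of_outer hm)) (.unfold index (of_outer hm)))
      (.middle (index.mul (of_outer hm)) (of_outer hm) (index.mul (of_outer hm)) (of_outer hm)))
    (.wires ((of_outer hm).add (of_outer hm)))
    (.fold index ((of_outer hm).add (of_outer hm))) fun _ _ => rfl

theorem generate {C : ∀ x, QCirc (a x) (m x)} (ha : PTime e fun x => unary (a x))
    (hm : PTime e fun x => unary (m x)) (hC : PTime e fun x => (C x).code)
    (hn : PTime e fun x => unary (n x)) :
    PTime e fun x => (QCirc.generate (C x) (n x)).code :=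
  code_recursion (F := fun x i => (QCirc.generate (C x) i).code)
    (P := fun x _ => (QCirc.copy (a x)).code)
    (R := fun x i => ((QCirc.assocR (a x) (i * m x) (m x)).seq
      ((QCirc.wires (a x)).par (QCirc.fold i (m x)))).code) hn
    (.par (.wires ha) (by simpa only [QCirc.code_cast] using const _))
    (.copy (of_outer ha)) (of_outer hC)
    (.seq (.assocR (of_outer ha) (index.mul (of_outer hm)) (of_outer hm))
      (.par (.wires (of_outer ha)) (.fold index (of_outer hm)))) fun _ _ => rfl

end PTime

namespace QPT

variable {a b : ℕ → ℕ}

theorem pTime_in (A : QPT a b) : PTime unary fun n => unary (a n) := (polyTime_iff.1 A.uniform).fst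

theorem pTime_out (A : QPT a b) : PTime unary fun n => unary (b n) :=
  (polyTime_iff.1 A.uniform).snd.fst

theorem pTime_code (A : QPT a b) : PTime unary fun n => (A.circ n).code :=
  (polyTime_iff.1 A.uniform).snd.snd

/-- A family of circuits whose numbers of wires and whose structure are computed in polynomial
time. -/
def ofCode (C : ∀ n, QCirc (a n) (b n)) (ha : PTime unary fun n => unary (a n))
    (hb : PTime unary fun n => unary (b n)) (hC : PTime unary fun n => (C n).code) : QPT a b :=
  ⟨C, polyTime_iff.2 (ha.node (hb.node hC))⟩

@[simp] theorem run_ofCode (C : ∀ n, QCirc (a n) (b n)) (ha hb hC) (n : ℕ) (ρ : Op (a n)) :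
    (ofCode C ha hb hC).run n ρ = (C n).run ρ := rfl

end QPT

end

/-! ### Probabilities of measurement outcomes -/

section

open QCirc
open BTree (unary)
open scoped ComplexOrder

variable {a b n : ℕ}

theorem run_zero (C : QCirc a b) : C.run 0 = 0 := by
  have := run_smul C 0 0
  rwa [zero_smul, zero_smul] at this

theorem run_dephase_of_posSemidef {ρ : Op n} (hρ : ρ.PosSemidef) :
    (dephase n).run ρ = ∑ x, (prob ρ x : ℂ) • ket x := by
  simp only [run_dephase, apply_eq_prob hρ]

theorem prob_ket (x y : Bits n) : prob (ket x) y = if y = x then 1 else 0 := by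
  simp only [prob, ket_apply, and_self]
  split_ifs <;> simp

/-- The real part is multiplicative here only because positivity makes both diagonal entries real.
-/
theorem prob_tensorState {ρ : Op a} {σ : Op b} (hρ : ρ.PosSemidef) (hσ : σ.PosSemidef)
    (x : Bits a) (y : Bits b) :
    prob (tensorState ρ σ) (Fin.append x y) = prob ρ x * prob σ y := by
  have : tensorState ρ σ (Fin.append x y) (Fin.append x y) = ρ x x * σ y y := by
    simp [tensorState]
  rw [prob, this, apply_eq_prob hρ, apply_eq_prob hσ, ← Complex.ofReal_mul, Complex.ofReal_re]

theorem prob_zero (x : Bits n) : prob (0 : Op n) x = 0 := by simp [prob]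

theorem accept_smul (r : ℝ) (ρ : Op 1) : accept ((r : ℂ) • ρ) = r * accept ρ := prob_smul _ _ _

theorem accept_sum {ι : Type*} (s : Finset ι) (ρ : ι → Op 1) :
    accept (∑ i ∈ s, ρ i) = ∑ i ∈ s, accept (ρ i) := prob_sum _ _ _

theorem posSemidef_one : Matrix.PosSemidef (1 : Op n) := Matrix.PosSemidef.one

theorem sum_prob_run_ket (C : QCirc a b) (x : Bits a) : ∑ y, prob (C.run (ket x)) y = 1 := by
  rw [sum_prob, trace_run, trace_ket, Complex.one_re]

namespace OWSGScheme

variable {κ m : ℕ → ℕ} (G : OWSGScheme κ m) (n : ℕ)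

theorem keyProb_nonneg (k : Bits (κ n)) : 0 ≤ G.keyProb n k :=
  prob_nonneg (posSemidef_run _ posSemidef_one) k

theorem sum_keyProb : ∑ k, G.keyProb n k = 1 := by
  have h : (1 : Op 0) = ket default := one_eq_ket _
  simp only [keyProb, QPT.run, h]
  exact sum_prob_run_ket _ _

theorem posSemidef_state (k : Bits (κ n)) : (G.state n k).PosSemidef :=
  posSemidef_run _ (posSemidef_ket k)

theorem trace_state (k : Bits (κ n)) : (G.state n k).trace = 1 := by
  rw [state, QPT.run, trace_run, trace_ket]

theorem verProb_nonneg (k : Bits (κ n)) {φ : Op (m n)} (hφ : φ.PosSemidef) :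
    0 ≤ G.verProb n k φ :=
  prob_nonneg (posSemidef_run _ (posSemidef_tensorState (posSemidef_ket k) hφ)) _

end OWSGScheme

/-! ### From signature schemes to one-way state generators -/

namespace QDSScheme

variable {l s p g : ℕ → ℕ} (S : QDSScheme l s p g)

/-- Signing the message `0` with a claimed key and verifying the signature. -/
def keyCheck (n : ℕ) : QCirc (s n + p n) 1 :=
  -- Dephasing turns the output of `sign` into a mixture of classical strings, as the signature must
  -- be measured before it is verified.
  (((zeros (s n) (l n)).seq ((S.sign.circ n).seq (dephase (g n)))).par (zeros (p n) (l n))).seq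
    ((swap (g n) (p n + l n)).seq ((assocR (p n) (l n) (g n)).seq (S.ver.circ n)))

/-- No circuit has exactly `l n` wires, so the message length is recovered as the input length of
`sign` minus the key length. -/
theorem pTime_l (S : QDSScheme l s p g) : PTime unary fun n => unary (l n) := by
  simpa only [Nat.add_sub_cancel_left] using S.sign.pTime_in.sub S.skGen.pTime_out

/-- The one-way state generator of a signature scheme. -/
def toOWSG : OWSGScheme s p where
  keyGen := S.skGen
  stateGen := S.pkGen
  ver := .ofCode S.keyCheck (S.pkGen.pTime_in.add S.pkGen.pTime_out) (.const _)
    (.seq (.par (.seq (.zeros S.pkGen.pTime_in S.pTime_l)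
        (.seq S.sign.pTime_code (.dephase S.sign.pTime_out)))
        (.zeros S.pkGen.pTime_out S.pTime_l))
      (.seq (.swap S.sign.pTime_out (S.pkGen.pTime_out.add S.pTime_l))
        (.seq (.assocR S.pkGen.pTime_out S.pTime_l S.sign.pTime_out) S.ver.pTime_code)))

variable (n : ℕ)

theorem posSemidef_pk (k : Bits (s n)) : (S.pk n k).PosSemidef :=
  posSemidef_run _ (posSemidef_ket k)

theorem posSemidef_sign (k : Bits (s n)) (μ : Bits (l n)) :
    (S.sign.run n (tensorState (ket k) (ket μ))).PosSemidef :=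
  posSemidef_run _ (posSemidef_tensorState (posSemidef_ket _) (posSemidef_ket _))

theorem sum_signProb (k : Bits (s n)) (μ : Bits (l n)) : ∑ σ, S.signProb n k μ σ = 1 := by
  simp only [signProb, tensorState_ket, QPT.run]
  exact sum_prob_run_ket _ _

theorem verProb_toOWSG (k : Bits (s n)) (φ : Op (p n)) :
    S.toOWSG.verProb n k φ =
      ∑ σ, S.signProb n k (fun _ => false) σ * S.verProb n φ (fun _ => false) σ := by
  have h := run_dephase_of_posSemidef (S.posSemidef_sign n k fun _ => false)
  rw [QPT.run] at h
  change accept ((S.keyCheck n).run (tensorState (ket k) φ)) = _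
  simp only [keyCheck, run_seq, run_par, run_zeros, h,
    tensorState_sum_left, tensorState_smul_left, run_sum, run_smul,
    run_swap, run_assocR, accept_sum, accept_smul]
  rfl

theorem correct_toOWSG (h : S.Correct) : S.toOWSG.Correct := by
  have h0 := h fun _ _ => false
  refine (congrArg Negligible (funext fun n => ?_)).mp h0
  simp only [correctProb, OWSGScheme.correctProb, verProb_toOWSG, Finset.mul_sum, mul_assoc]
  rfl

variable {n}

/-- The adversary that finds a key from the public keys and then signs the message `0` with it. -/
def keyAdversary (t : Polynomial ℕ) (A : QPT (fun n => t.eval n * p n) s) :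
    OneTimeAdversary l p g t where
  w n := t.eval n * p n
  query := .ofCode (fun n => (ones (t.eval n * p n) (l n)).seq (swap (t.eval n * p n) (l n)))
    A.pTime_in (S.pTime_l.add A.pTime_in)
    (.seq (.ones A.pTime_in S.pTime_l) (.swap A.pTime_in S.pTime_l))
  forge := .ofCode (fun n => (dropLeft (g n) (t.eval n * p n)).seq ((A.circ n).seq
      -- The found key has to be measured before signing; the resulting signature needs no
      -- dephasing, since the game measures the final output.
      ((dephase (s n)).seq ((zeros (s n) (l n)).seq ((S.sign.circ n).seq
        ((zeros (g n) (l n)).seq (swap (g n) (l n))))))))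
    (S.sign.pTime_out.add A.pTime_in) (S.pTime_l.add S.sign.pTime_out)
    (.seq (.dropLeft S.sign.pTime_out A.pTime_in) (.seq A.pTime_code
      (.seq (.dephase A.pTime_out) (.seq (.zeros A.pTime_out S.pTime_l) (.seq S.sign.pTime_code
        (.seq (.zeros S.sign.pTime_out S.pTime_l) (.swap S.sign.pTime_out S.pTime_l)))))))

variable {t : Polynomial ℕ} (A : QPT (fun n => t.eval n * p n) s)

theorem afterMeasuring_keyAdversary (ρ : Op (t.eval n * p n)) (μ : Bits (l n)) :
    afterMeasuring ((S.keyAdversary t A).query.run n ρ) μ =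
      if μ = fun _ => true then ρ else 0 := by
  change afterMeasuring (((ones (t.eval n * p n) (l n)).seq (swap _ (l n))).run ρ) μ = _
  rw [run_seq, run_ones, run_swap, afterMeasuring_tensorState_ket]

theorem prob_forge_keyAdversary {ρ : Op (t.eval n * p n)} (hρ : ρ.PosSemidef) (σ σ' : Bits (g n))
    (μ : Bits (l n)) :
    prob ((S.keyAdversary t A).forge.run n (tensorState (ket σ) ρ)) (Fin.append μ σ') =
      if μ = fun _ => false then
        ∑ k, prob (A.run n ρ) k * S.signProb n k (fun _ => false) σ' else 0 := by
  have hA := run_dephase_of_posSemidef (posSemidef_run (A.circ n) hρ)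
  simp only [keyAdversary, QPT.run_ofCode, run_seq, run_dropLeft_tensorState, trace_ket, one_smul,
    hA, run_sum, run_smul, run_zeros, run_swap, prob_sum, prob_smul]
  have hS : ∀ k, prob (tensorState (ket fun _ => false)
      ((S.sign.circ n).run (tensorState (ket k) (ket fun _ => false)))) (Fin.append μ σ') =
      if μ = fun _ => false then S.signProb n k (fun _ => false) σ' else 0 := fun k => by
    have h := prob_tensorState (posSemidef_ket fun _ => false)
      (S.posSemidef_sign n k fun _ => false) μ σ'
    rw [QPT.run] at h
    rw [h, prob_ket, ite_mul, one_mul, zero_mul]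
    rfl
  simp only [hS]
  split_ifs
  · rfl
  · simp

theorem attackProb_keyAdversary (hl : 1 ≤ l n) :
    S.attackProb (S.keyAdversary t A) n = S.toOWSG.attackProb t A n := by
  -- The only use of `1 ≤ l n`: the query and the forged message are distinct.
  have hne : (fun _ => false : Bits (l n)) ≠ fun _ => true := fun h =>
    Bool.false_ne_true (congrFun h ⟨0, hl⟩)
  have hterm : ∀ (k : Bits (s n)) (μ : Bits (l n)) (σ : Bits (g n)) (μ' : Bits (l n))
      (σ' : Bits (g n)),
      (if μ' ≠ μ then S.skProb n k * S.signProb n k μ σ *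
        prob ((S.keyAdversary t A).forge.run n (tensorState (ket σ)
          (afterMeasuring ((S.keyAdversary t A).query.run n (copies (t.eval n) (S.pk n k))) μ)))
          (Fin.append μ' σ') * S.verProb n (S.pk n k) μ' σ' else 0) =
      if μ = fun _ => true then (if μ' = fun _ => false then
        S.signProb n k (fun _ => true) σ * (S.skProb n k *
        (∑ k', prob (A.run n (copies (t.eval n) (S.pk n k))) k' *
          S.signProb n k' (fun _ => false) σ') * S.verProb n (S.pk n k) (fun _ => false) σ')
        else 0) else 0 := by
    intro k μ σ μ' σ'
    rw [afterMeasuring_keyAdversary]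
    by_cases hμ : μ = fun _ => true
    · subst hμ
      rw [if_pos rfl, if_pos rfl, prob_forge_keyAdversary _ _
        (posSemidef_copies _ (S.posSemidef_pk n k))]
      by_cases hμ' : μ' = fun _ => false
      · subst hμ'
        rw [if_pos hne, if_pos rfl, if_pos rfl]
        ring
      · simp [hμ']
    · rw [if_neg hμ, if_neg hμ, prob_forge_keyAdversary _ _ Matrix.PosSemidef.zero, QPT.run,
        run_zero]
      simp [prob_zero]
  simp only [attackProb, OWSGScheme.attackProb, hterm]
  refine Finset.sum_congr rfl fun k _ => ?_
  have h1 : ∀ (f : Bits (g n) → Bits (g n) → ℝ),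
      (∑ μ : Bits (l n), ∑ σ, ∑ μ' : Bits (l n), ∑ σ', if μ = fun _ => true then
        (if μ' = fun _ => false then f σ σ' else 0) else 0) = ∑ σ, ∑ σ', f σ σ' := by
    intro f
    rw [Finset.sum_eq_single (fun _ => true)]
    · refine Finset.sum_congr rfl fun σ _ => ?_
      rw [Finset.sum_eq_single (fun _ => false)]
      · simp
      · intro μ' _ h
        simp [h]
      · simp
    · intro μ _ h
      simp [h]
    · simp
  -- The signature received from the challenger is ignored, so its probabilities sum to one.
  rw [h1, ← Finset.sum_mul_sum, sum_signProb, one_mul]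
  simp only [verProb_toOWSG, Finset.mul_sum, Finset.sum_mul]
  rw [Finset.sum_comm]
  refine Finset.sum_congr rfl fun k' _ => Finset.sum_congr rfl fun σ' _ => ?_
  change S.skProb n k * (_ * _) * _ = S.skProb n k * _ * _
  simp only [mul_assoc]
  rfl

theorem isOWSG_toOWSG (hl : ∀ n, 1 ≤ l n) (h : S.IsOneTimeQDS) : S.toOWSG.IsOWSG := by
  refine ⟨S.correct_toOWSG h.1, fun t A => ?_⟩
  have := h.2 t (S.keyAdversary t A)
  rwa [show S.attackProb (S.keyAdversary t A) = S.toOWSG.attackProb t A from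
    funext fun n => S.attackProb_keyAdversary A (hl n)] at this

end QDSScheme

end

section

open QCirc
open BTree (unary)
open scoped ComplexOrder

/-! ### From one-way state generators to signature schemes -/

namespace OWSGScheme

variable {κ m : ℕ → ℕ} (G : OWSGScheme κ m)

/-- Verification of a signature of one bit with the state that the bit selects. -/
def selectAndVerify (n : ℕ) : QCirc (m n + m n + (1 + κ n)) 1 :=
  (assocL (m n + m n) 1 (κ n)).seq (((mux (m n)).par (wires (κ n))).seq
    ((swap (m n) (κ n)).seq (G.ver.circ n)))

/-- Lamport's signature scheme for one-bit messages. -/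
def toQDS : QDSScheme (fun _ => 1) (fun n => κ n + κ n) (fun n => m n + m n) κ where
  skGen := .ofCode (fun n => (G.keyGen.circ n).par (G.keyGen.circ n)) (.const _)
    (G.keyGen.pTime_out.add G.keyGen.pTime_out) (.par G.keyGen.pTime_code G.keyGen.pTime_code)
  pkGen := .ofCode (fun n => (G.stateGen.circ n).par (G.stateGen.circ n))
    (G.keyGen.pTime_out.add G.keyGen.pTime_out) (G.stateGen.pTime_out.add G.stateGen.pTime_out)
    (.par G.stateGen.pTime_code G.stateGen.pTime_code)
  sign := .ofCode (fun n => mux (κ n)) (.succ (G.keyGen.pTime_out.add G.keyGen.pTime_out))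
    G.keyGen.pTime_out (.mux G.keyGen.pTime_out)
  ver := .ofCode G.selectAndVerify
    ((G.stateGen.pTime_out.add G.stateGen.pTime_out).add
      (.add (.const (unary 1)) G.keyGen.pTime_out))
    (.const _)
    (.seq (.assocL (G.stateGen.pTime_out.add G.stateGen.pTime_out) (.const (unary 1))
        G.keyGen.pTime_out)
      (.seq (.par (.mux G.stateGen.pTime_out) (.wires G.keyGen.pTime_out))
        (.seq (.swap G.stateGen.pTime_out G.keyGen.pTime_out) G.ver.pTime_code)))

variable (n : ℕ)

theorem skProb_toQDS (k₀ k₁ : Bits (κ n)) :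
    G.toQDS.skProb n (Fin.append k₀ k₁) = G.keyProb n k₀ * G.keyProb n k₁ := by
  have h := run_par (G.keyGen.circ n) (G.keyGen.circ n) 1 1
  rw [tensorState_one] at h
  change prob (((G.keyGen.circ n).par (G.keyGen.circ n)).run 1) _ = _
  rw [h]
  exact prob_tensorState (posSemidef_run _ posSemidef_one) (posSemidef_run _ posSemidef_one) _ _

theorem pk_toQDS (k₀ k₁ : Bits (κ n)) :
    G.toQDS.pk n (Fin.append k₀ k₁) = tensorState (G.state n k₀) (G.state n k₁) := by
  change ((G.stateGen.circ n).par (G.stateGen.circ n)).run (ket (Fin.append k₀ k₁)) = _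
  rw [← tensorState_ket, run_par]
  rfl

theorem signProb_toQDS (k₀ k₁ : Bits (κ n)) (v : Bool) (σ : Bits (κ n)) :
    G.toQDS.signProb n (Fin.append k₀ k₁) (fun _ => v) σ =
      if σ = (bif v then k₁ else k₀) then 1 else 0 := by
  change prob ((mux (κ n)).run (tensorState (ket (Fin.append k₀ k₁)) (ket fun _ => v))) σ = _
  rw [← tensorState_ket, run_mux]
  cases v <;> simp [prob_ket]

theorem verProb_toQDS (k₀ k₁ : Bits (κ n)) (v : Bool) (σ : Bits (κ n)) :
    G.toQDS.verProb n (G.toQDS.pk n (Fin.append k₀ k₁)) (fun _ => v) σ =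
      G.verProb n σ (G.state n (bif v then k₁ else k₀)) := by
  rw [pk_toQDS]
  change accept ((G.selectAndVerify n).run (tensorState (tensorState (G.state n k₀) (G.state n k₁))
    (tensorState (ket fun _ => v) (ket σ)))) = _
  rw [selectAndVerify, run_seq, run_seq, run_seq, run_assocL, run_par, run_mux]
  -- The factor left by `mux` is the trace of the state that was not selected, which is one.
  cases v <;> simp only [cond_true, cond_false, trace_state, one_smul, run_wires, run_swap] <;> rfl

theorem bits_one_eq (μ : Bits 1) : μ = fun _ => μ 0 := by
  funext i; fin_cases i; rfl

/-- The key that belongs to the other bit enters only through its probability and sums out. -/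
theorem correctProb_toQDS (μ : Bits 1) : G.toQDS.correctProb n μ = G.correctProb n := by
  rw [bits_one_eq μ]
  simp only [QDSScheme.correctProb, sum_bits_add, skProb_toQDS, signProb_toQDS, verProb_toQDS]
  simp only [mul_ite, mul_one, mul_zero, ite_mul, zero_mul, Finset.sum_ite_eq', Finset.mem_univ,
    if_true]
  cases μ 0
  · simp only [cond_false, correctProb]
    refine Finset.sum_congr rfl fun k _ => ?_
    rw [Finset.sum_congr rfl fun k' _ => mul_right_comm _ _ _, ← Finset.mul_sum, sum_keyProb,
      mul_one]
  · simp only [cond_true, correctProb]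
    rw [Finset.sum_comm]
    refine Finset.sum_congr rfl fun k _ => ?_
    simp only [mul_assoc, ← Finset.sum_mul, sum_keyProb, one_mul]

variable {t : Polynomial ℕ} (A : OneTimeAdversary (fun _ => 1) (fun n => m n + m n) κ t)

/-- A freshly generated key with copies of its state. -/
def freshKey (t : Polynomial ℕ) (n : ℕ) : QCirc 0 (κ n + t.eval n * m n) :=
  (G.keyGen.circ n).seq ((dephase (κ n)).seq (generate (G.stateGen.circ n) (t.eval n)))

/-- The attack on the generator that plays the one-time game with a fresh key next to the given
states, which are put in the position `v`. -/
def embed (v : Bool) (n : ℕ) : QCirc (t.eval n * m n) (κ n) :=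
  ((wires (t.eval n * m n)).par (G.freshKey t n)).seq
    ((leftComm (t.eval n * m n) (κ n) (t.eval n * m n)).seq
      (((wires (κ n)).par ((bif v then swap (t.eval n * m n) (t.eval n * m n) else wires _).seq
        ((interleave (m n) (t.eval n)).seq ((A.query.circ n).seq (dropLeft 1 (A.w n)))))).seq
      ((A.forge.circ n).seq (dropLeft 1 (κ n)))))

theorem pTime_embed (v : Bool) : PTime unary fun n => (G.embed A v n).code := by
  have ht : PTime unary fun n => unary (t.eval n) := PTime.id.eval_polynomial t
  have hm := G.stateGen.pTime_out
  have hκ := G.keyGen.pTime_out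
  -- The length of the adversary's memory is the input length of `forge` minus that of a signature.
  have hw : PTime unary fun n => unary (A.w n) := by
    simpa only [Nat.add_sub_cancel_left] using A.forge.pTime_in.sub hκ
  have hb : PTime unary fun n =>
      (bif v then swap (t.eval n * m n) (t.eval n * m n) else wires _).code := by
    cases v
    · exact .wires ((ht.mul hm).add (ht.mul hm))
    · exact .swap (ht.mul hm) (ht.mul hm)
  exact .seq (.par (.wires (ht.mul hm)) (.seq G.keyGen.pTime_code (.seq (.dephase hκ)
      (.generate hκ hm G.stateGen.pTime_code ht))))
    (.seq (.leftComm (ht.mul hm) hκ (ht.mul hm))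
      (.seq (.par (.wires hκ) (.seq hb (.seq (.interleave hm ht)
        (.seq A.query.pTime_code (.dropLeft (.const (unary 1)) hw)))))
        (.seq A.forge.pTime_code (.dropLeft (.const (unary 1)) hκ))))

/-- The circuits `embed` as an algorithm. -/
def embedAdversary (v : Bool) : QPT (fun n => t.eval n * m n) κ :=
  .ofCode (G.embed A v) ((PTime.id.eval_polynomial t).mul G.stateGen.pTime_out)
    G.keyGen.pTime_out (G.pTime_embed A v)

variable {n}

/-- The probability that the adversary, after asking for a signature of `μ` and receiving `k`,
returns the message `μ'` and the signature `σ`. -/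
def forgeProb (k k₀ k₁ : Bits (κ n)) (μ μ' : Bits 1) (σ : Bits (κ n)) : ℝ :=
  prob (A.forge.run n (tensorState (ket k) (afterMeasuring (A.query.run n
    (copies (t.eval n) (tensorState (G.state n k₀) (G.state n k₁)))) μ))) (Fin.append μ' σ)

theorem forgeProb_nonneg (k k₀ k₁ : Bits (κ n)) (μ μ' : Bits 1) (σ : Bits (κ n)) :
    0 ≤ G.forgeProb A k k₀ k₁ μ μ' σ :=
  prob_nonneg (posSemidef_run _ (posSemidef_tensorState (posSemidef_ket _)
    (posSemidef_afterMeasuring (posSemidef_run _ (posSemidef_copies _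
      (posSemidef_tensorState (G.posSemidef_state _ _) (G.posSemidef_state _ _)))) _))) _

theorem run_freshKey : (G.freshKey t n).run 1 = ∑ k : Bits (κ n), (G.keyProb n k : ℂ) •
    tensorState (ket k) (copies (t.eval n) (G.state n k)) := by
  rw [freshKey, run_seq, run_seq, run_dephase_of_posSemidef (posSemidef_run _ posSemidef_one),
    run_sum]
  simp only [run_smul, run_generate]
  rfl

/-- The attack discards both the queried and the forged message, which amounts to summing over their
outcomes `μ` and `μ'`; the fresh key is handed over for every `μ`. -/
theorem prob_embedAdversary (v : Bool) (k σ : Bits (κ n)) :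
    prob ((G.embedAdversary A v).run n (copies (t.eval n) (G.state n k))) σ =
      ∑ k', G.keyProb n k' * ∑ μ, ∑ μ',
        G.forgeProb A k' (bif v then k' else k) (bif v then k else k') μ μ' σ := by
  have hpos : ∀ (ρ τ : Op (m n)),
      (bif v then swap (t.eval n * m n) (t.eval n * m n) else wires _).run
        (tensorState (copies (t.eval n) ρ) (copies (t.eval n) τ)) =
      tensorState (copies (t.eval n) (bif v then τ else ρ))
        (copies (t.eval n) (bif v then ρ else τ)) := by
    intro ρ τ
    cases v
    · exact run_wires _
    · exact run_swap _ _
  change prob ((G.embed A v n).run (copies (t.eval n) (G.state n k))) σ = _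
  simp only [embed, run_seq, run_par_of_zero, run_freshKey, tensorState_sum_right,
    tensorState_smul_right, run_sum, run_smul, run_leftComm, run_par, run_wires, hpos,
    run_interleave, run_dropLeft, prob_sum, prob_smul]
  have hst : ∀ k₀ k₁, (bif v then G.state n k₀ else G.state n k₁) =
      G.state n (bif v then k₀ else k₁) := fun _ _ => (Bool.apply_cond (G.state n)).symm
  simp only [hst]
  rfl

/-- The probability that the adversary wins after asking for a signature of `!v`. -/
def winProb (v : Bool) (n : ℕ) : ℝ :=
  ∑ k₀, ∑ k₁, ∑ σ, G.keyProb n k₀ * G.keyProb n k₁ *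
    G.forgeProb A (bif v then k₀ else k₁) k₀ k₁ (fun _ => !v) (fun _ => v) σ *
      G.verProb n σ (G.state n (bif v then k₁ else k₀))

theorem winProb_nonneg (v : Bool) : 0 ≤ G.winProb A v n :=
  Finset.sum_nonneg fun _ _ => Finset.sum_nonneg fun _ _ => Finset.sum_nonneg fun _ _ =>
    mul_nonneg (mul_nonneg (mul_nonneg (G.keyProb_nonneg n _) (G.keyProb_nonneg n _))
      (G.forgeProb_nonneg A _ _ _ _ _ _)) (G.verProb_nonneg n _ (G.posSemidef_state n _))

theorem sum_bits_one_const {M : Type*} [AddCommMonoid M] (f : Bits 1 → M) :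
    ∑ x, f x = f (fun _ => false) + f fun _ => true := by
  rw [sum_bits_one, bits_one_eq ![false], bits_one_eq ![true]]
  rfl

/-- With one-bit messages, `μ' ≠ μ` forces the query to be the negation of the forged bit, and
signing is deterministic, so the sum over `σ` collapses to the selected key. -/
theorem attackProb_toQDS :
    G.toQDS.attackProb A n = G.winProb A false n + G.winProb A true n := by
  have hterm : ∀ (k₀ k₁ : Bits (κ n)) (u v : Bool) (σ σ' : Bits (κ n)),
      (if (fun _ => v : Bits 1) ≠ (fun _ => u) then
        G.toQDS.skProb n (Fin.append k₀ k₁) *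
          G.toQDS.signProb n (Fin.append k₀ k₁) (fun _ => u) σ *
        prob (A.forge.run n (tensorState (ket σ) (afterMeasuring (A.query.run n
          (copies (t.eval n) (G.toQDS.pk n (Fin.append k₀ k₁)))) (fun _ => u))))
          (Fin.append (fun _ => v) σ') *
        G.toQDS.verProb n (G.toQDS.pk n (Fin.append k₀ k₁)) (fun _ => v) σ' else 0) =
      if v = u then 0 else if σ = (bif u then k₁ else k₀) then
        G.keyProb n k₀ * G.keyProb n k₁ *
          G.forgeProb A (bif u then k₁ else k₀) k₀ k₁ (fun _ => u) (fun _ => v) σ' *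
          G.verProb n σ' (G.state n (bif v then k₁ else k₀)) else 0 := by
    intro k₀ k₁ u v σ σ'
    have huv : (fun _ => v : Bits 1) ≠ (fun _ => u) ↔ ¬ v = u := by
      revert u v; decide
    rw [verProb_toQDS, skProb_toQDS, signProb_toQDS, pk_toQDS]
    by_cases h : v = u
    · rw [if_neg fun h' => huv.1 h' h, if_pos h]
    · rw [if_pos (huv.2 h), if_neg h]
      by_cases hσ : σ = (bif u then k₁ else k₀)
      · rw [if_pos hσ, if_pos hσ, mul_one, ← hσ]
        rfl
      · rw [if_neg hσ, if_neg hσ]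
        simp
  simp only [QDSScheme.attackProb, sum_bits_add, sum_bits_one_const, hterm, winProb]
  simp only [if_true, Bool.false_eq_true, Bool.true_eq_false, if_false, cond_true, cond_false,
    Finset.sum_const_zero, zero_add, add_zero, Bool.not_true, Bool.not_false,
    ← Finset.sum_add_distrib]
  refine Finset.sum_congr rfl fun k₀ _ => Finset.sum_congr rfl fun k₁ _ => ?_
  rw [Finset.sum_comm]
  refine Finset.sum_congr rfl fun σ _ => ?_
  simp only [Finset.sum_add_distrib, Finset.sum_ite_eq', Finset.mem_univ, if_true]
  exact add_comm _ _

/-- The winning pair of messages `(!v, v)` is one term of the nonnegative sum over `μ` and `μ'`.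
After enlarging to the full sum, only the order of summation differs: the challenge key is `k₀` or
`k₁` according to `v`. -/
theorem winProb_le (v : Bool) : G.winProb A v n ≤ G.attackProb t (G.embedAdversary A v) n := by
  have hK := G.keyProb_nonneg n
  have hF : ∀ k k₀ k₁ σ : Bits (κ n), G.forgeProb A k k₀ k₁ (fun _ => !v) (fun _ => v) σ ≤
      ∑ μ, ∑ μ', G.forgeProb A k k₀ k₁ μ μ' σ := fun k k₀ k₁ σ =>
    (Finset.single_le_sum (f := fun μ' => G.forgeProb A k k₀ k₁ (fun _ => !v) μ' σ)
      (fun μ' _ => G.forgeProb_nonneg A _ _ _ _ μ' _) (Finset.mem_univ _)).trans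
    (Finset.single_le_sum (f := fun μ => ∑ μ', G.forgeProb A k k₀ k₁ μ μ' σ)
      (fun μ _ => Finset.sum_nonneg fun μ' _ => G.forgeProb_nonneg A _ _ _ μ μ' _)
      (Finset.mem_univ _))
  have hV : ∀ k σ, 0 ≤ G.verProb n σ (G.state n k) := fun k σ =>
    G.verProb_nonneg n _ (G.posSemidef_state n _)
  have key : G.winProb A v n ≤ ∑ k₀, ∑ k₁, ∑ σ, G.keyProb n k₀ * G.keyProb n k₁ *
      (∑ μ, ∑ μ', G.forgeProb A (bif v then k₀ else k₁) k₀ k₁ μ μ' σ) *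
        G.verProb n σ (G.state n (bif v then k₁ else k₀)) :=
    Finset.sum_le_sum fun k₀ _ => Finset.sum_le_sum fun k₁ _ => Finset.sum_le_sum fun σ _ =>
      mul_le_mul_of_nonneg_right
        (mul_le_mul_of_nonneg_left (hF _ _ _ _) (mul_nonneg (hK _) (hK _))) (hV _ _)
  refine key.trans (le_of_eq ?_)
  simp only [attackProb, prob_embedAdversary]
  cases v
  · refine Finset.sum_congr rfl fun k₀ _ => ?_
    rw [Finset.sum_comm]
    refine Finset.sum_congr rfl fun σ _ => ?_
    rw [Finset.mul_sum, Finset.sum_mul]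
    refine Finset.sum_congr rfl fun k₁ _ => ?_
    simp only [cond_false, mul_assoc]
  · rw [Finset.sum_comm]
    refine Finset.sum_congr rfl fun k₁ _ => ?_
    rw [Finset.sum_comm]
    refine Finset.sum_congr rfl fun σ _ => ?_
    rw [Finset.mul_sum, Finset.sum_mul]
    refine Finset.sum_congr rfl fun k₀ _ => ?_
    simp only [cond_true]
    ring

theorem isOneTimeQDS_toQDS (h : G.IsOWSG) : G.toQDS.IsOneTimeQDS := by
  refine ⟨fun μ => ?_, fun t A => ?_⟩
  · simp only [correctProb_toQDS]
    exact h.1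
  · have h0 : Negligible (G.winProb A false) := (h.2 t (G.embedAdversary A false)).trans_abs_le
      fun n => by
        rw [abs_of_nonneg (G.winProb_nonneg A false)]
        exact (G.winProb_le A false).trans (le_abs_self _)
    have h1 : Negligible (G.winProb A true) := (h.2 t (G.embedAdversary A true)).trans_abs_le
      fun n => by
        rw [abs_of_nonneg (G.winProb_nonneg A true)]
        exact (G.winProb_le A true).trans (le_abs_self _)
    exact (funext fun n => G.attackProb_toQDS A : G.toQDS.attackProb A = _) ▸ h0.add h1

end OWSGScheme

end

end QCrypto

end

/-! ### The equivalence and the two explicit constructions -/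

theorem mainTheorem3 :
    -- existence of the two primitives is equivalent
    ((∃ (κ m : ℕ → ℕ) (G : QCrypto.OWSGScheme κ m), G.IsOWSG) ↔
      ∃ (l s p g : ℕ → ℕ) (S : QCrypto.QDSScheme l s p g),
        (∀ n, 1 ≤ l n) ∧ S.IsOneTimeQDS) ∧
    -- every generator gives a signature scheme for one-bit messages
    (∀ (κ m : ℕ → ℕ) (G : QCrypto.OWSGScheme κ m), G.IsOWSG →
      ∃ S : QCrypto.QDSScheme (fun _ => 1) (fun n => κ n + κ n) (fun n => m n + m n) κ,
        S.IsOneTimeQDS ∧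
        ∀ (n : ℕ) (k₀ k₁ : QCrypto.Bits (κ n)),
          S.skProb n (Fin.append k₀ k₁) = G.keyProb n k₀ * G.keyProb n k₁ ∧
          S.pk n (Fin.append k₀ k₁) = QCrypto.tensorState (G.state n k₀) (G.state n k₁) ∧
          ∀ (b : Bool) (σ : QCrypto.Bits (κ n)),
            S.signProb n (Fin.append k₀ k₁) (fun _ => b) σ =
              (if σ = (if b then k₁ else k₀) then 1 else 0) ∧
            S.verProb n (S.pk n (Fin.append k₀ k₁)) (fun _ => b) σ =
              G.verProb n σ (G.state n (if b then k₁ else k₀))) ∧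
    -- the keys of every signature scheme are the keys and states of a generator
    (∀ (l s p g : ℕ → ℕ) (S : QCrypto.QDSScheme l s p g), (∀ n, 1 ≤ l n) → S.IsOneTimeQDS →
      ∃ G : QCrypto.OWSGScheme s p,
        G.IsOWSG ∧ G.keyGen = S.skGen ∧ G.stateGen = S.pkGen) := by
  refine ⟨⟨?_, ?_⟩, ?_, ?_⟩
  · rintro ⟨κ, m, G, hG⟩
    exact ⟨_, _, _, _, G.toQDS, fun _ => le_rfl, G.isOneTimeQDS_toQDS hG⟩
  · rintro ⟨l, s, p, g, S, hl, hS⟩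
    exact ⟨_, _, S.toOWSG, S.isOWSG_toOWSG hl hS⟩
  · intro κ m G hG
    refine ⟨G.toQDS, G.isOneTimeQDS_toQDS hG, fun n k₀ k₁ =>
      ⟨G.skProb_toQDS n k₀ k₁, G.pk_toQDS n k₀ k₁, fun b σ => ?_⟩⟩
    rw [G.signProb_toQDS, G.verProb_toQDS]
    cases b <;> simp
  · intro l s p g S hl hS
    exact ⟨S.toOWSG, S.isOWSG_toOWSG hl hS, rfl, rfl⟩
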